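/- **Setting.** Let $n,r\ge 1$, $t$ an indeterminate, $q=t^2$, $\mathcal A=\mathbb Z[t,t^{-1}]$. Let $W$ be the group of all permutations $\sigma$ of $\mathbb Z$ with $\sigma(i+r)=\sigma(i)+r$ for all $i$ (the extended affine Weyl group of type $\tilde A_{r-1}$), $\rho\in W$ the shift $j\mapsto j+1$, and $S=\{s_0,\dots,s_{r-1}\}$, where $s_i(j)=j+1$ if $j\equiv i$, $s_i(j)=j-1$ if $j\equiv i+1$, and $s_i(j)=j$ otherwise (congruences mod $r$; $S=\emptyset$ if $r=1$). With $W'=\langle S\rangle$ and $\Omega=\langle\rho\rangle$ one has $W=\Omega\ltimes W'$; the length $l$ and the Bruhat order of the Coxeter group $(W',S)$ are extended to $W$ by $l(\rho^k w')=l(w')$, and $\rho^k y'\le\rho^m w'$ iff $k=m$ and $y'\le w'$ $(y',w'\in W')$. Let $\mathcal H$ be the extended affine Hecke algebra: the $\mathcal A$-algebra with basis $\{T_w\}_{w\in W}$, $T_1=1$, and relations $T_wT_{w'}=T_{ww'}$ if $l(ww')=l(w)+l(w')$, $(T_s+1)(T_s-q)=0$ for $s\in S$. Let $\bar{\ }$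 be the ring involution of $\mathcal H$ with $\bar t=t^{-1}$, $\overline{T_w}=(T_{w^{-1}})^{-1}$. For $w\in W$ let $C_w\in\mathcal H$ be the Kazhdan–Lusztig basis element, i.e. the unique element with $\overline{C_w}=C_w$ and $C_w=q^{-l(w)/2}\sum_{y\le w}P_{y,w}(q)T_y$, where $P_{w,w}=1$ and, for $y<w$, $P_{y,w}\in\mathbb Z[q]$ has degree at most $\frac12(l(w)-l(y)-1)$. Let $\Lambda(n,r)$ be the set of families $\lambda=(\lambda_i)_{i\in\mathbb Z}$ of natural numbers with $\lambda_i=\lambda_{i-n}$ for all $i$ and $\lambda_1+\dots+\lambda_n=r$. For $\lambda\in\Lambda(n,r)$ let $W_\lambda$ be the standard Young subgroup, generated by the $s_i$ with $1\le i\le r-1$ and $i\ne\lambda_1+\dots+\lambda_k$ for all $1\le k\le n$, and let $x_\lambda=\sum_{w\in W_\lambda}T_w$. The affine $q$-Schur algebra is $$\mathcal S=\mathrm{End}_{\mathcal H}\Big(\bigoplus_{\lambda\in\Lambda(n,r)}x_\lambda\mathcal H\Big)$$ (endomorphisms of right $\mathcal H$-modules). For $\lambda,\mu\in\Lambda(n,r)$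 let $\mathcal D_{\lambda\mu}$ be the set of elements of minimal length in the double cosets in $W_\lambda\backslash W/W_\mu$; for $w\in\mathcal D_{\lambda\mu}$ let $w^+$ be the longest element of $W_\lambda wW_\mu$, let $T_{W_\lambda wW_\mu}=\sum_{x\in W_\lambda wW_\mu}T_x$, and let $\phi^w_{\lambda,\mu}\in\mathcal S$ be given by $\phi^w_{\lambda,\mu}(x_\nu h)=\delta_{\mu\nu}T_{W_\lambda wW_\mu}h\in x_\lambda\mathcal H$ for $\nu\in\Lambda(n,r)$, $h\in\mathcal H$. Define $\alpha_{z,w}\in\mathcal A$ (zero for all but finitely many $z$) by $C_{w^+}=\sum_{z\in\mathcal D_{\lambda\mu}}\alpha_{z,w}T_{W_\lambda zW_\mu}$. Let $w_{0,\mu}$ be the longest element of $W_\mu$. Let $\mathcal B$ be the set of triples $B=(\lambda,w_B,\mu)$ with $\lambda,\mu\in\Lambda(n,r)$, $w_B\in\mathcal D_{\lambda\mu}$, and put $$\theta_B=t^{\,l(w_{0,\mu})}\sum_{z\in\mathcal D_{\lambda\mu}}\alpha_{z,w_B}\,\phi^z_{\lambda,\mu}.$$ **Theorem.** (1) The elements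 $\{\theta_B\}_{B\in\mathcal B}$ form an $\mathcal A$-basis of $\mathcal S$. (2) For every $B=(\lambda,w_B,\mu)\in\mathcal B$, the endomorphism $\theta_B$ is the composite of the projection onto $x_\mu\mathcal H$, an $\mathcal H$-linear map $x_\mu\mathcal H\to x_\lambda\mathcal H$ and the inclusion of $x_\lambda\mathcal H$; regarding $\theta_B$ as that map, $C_{w_{0,\mu}}\in x_\mu\mathcal H$ and $\theta_B(C_{w_{0,\mu}})=C_{w_B^+}$. -/

import Mathlib

open scoped LaurentPolynomial DirectSum

noncomputable section

namespace AffineSchur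

/-- The unique element satisfying `P`, and the dummy value `d` if there is not exactly one. -/
def theUnique {α : Type*} (d : α) (P : α → Prop) : α :=
  open Classical in if h : ∃! a, P a then h.choose else d

/-! ### The extended affine Weyl group of type `Ã_{r-1}` -/

/-- The permutations `σ` of `ℤ` with `σ (i + r) = σ i + r` for all `i`. -/
def extAffineWeyl (r : ℕ) : Subgroup (Equiv.Perm ℤ) where
  carrier := {σ | ∀ i : ℤ, σ (i + r) = σ i + r}
  mul_mem' := by
    intro a b ha hb i
    have ha' : ∀ i : ℤ, a (i + r) = a i + r := ha
    have hb' : ∀ i : ℤ, b (i + r) = b i + r := hb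
    simp [Equiv.Perm.mul_apply, hb', ha']
  one_mem' := by intro i; simp
  inv_mem' := by
    intro a ha i
    have ha' : ∀ i : ℤ, a (i + r) = a i + r := ha
    rw [Equiv.Perm.inv_eq_iff_eq, ha']
    simp

abbrev W (r : ℕ) : Type := extAffineWeyl r

/-- `s` is the simple reflection `s_i`: it sends `j` to `j + 1` if `j ≡ i` mod `r`, to `j - 1` if
`j ≡ i + 1` mod `r`, and fixes all other `j`. (For `r = 1` there is no such permutation, so that
`S` is empty, as it should be in type `Ã₀`.) -/
def IsSimple (r : ℕ) (i : ℤ) (s : W r) : Prop :=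
  ∀ j : ℤ, (j ≡ i [ZMOD r] → s.1 j = j + 1) ∧ (j ≡ i + 1 [ZMOD r] → s.1 j = j - 1) ∧
    (¬ j ≡ i [ZMOD r] → ¬ j ≡ i + 1 [ZMOD r] → s.1 j = j)

/-- `S = {s_0, …, s_{r-1}}`. -/
def simpleRefl (r : ℕ) : Set (W r) := {s | ∃ i : ℤ, 0 ≤ i ∧ i < r ∧ IsSimple r i s}

/-- The shift `ρ : j ↦ j + 1`. -/
def shift (r : ℕ) : W r :=
  ⟨Equiv.addRight (1 : ℤ), fun i => by simp [add_right_comm]⟩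

/-- The length function on `W = Ω ⋉ W'`: the length of `ρ^k w'` with `w' ∈ W' = ⟨S⟩` is the least
length of a word in `S` that represents `w'`. -/
def len {r : ℕ} (w : W r) : ℕ :=
  sInf {m | ∃ (k : ℤ) (L : List (W r)), (∀ s ∈ L, s ∈ simpleRefl r) ∧
    w = shift r ^ k * L.prod ∧ L.length = m}

/-- The reflections: the conjugates of the simple reflections. -/
def reflections (r : ℕ) : Set (W r) := {t | ∃ x : W r, ∃ s ∈ simpleRefl r, t = x * s * x⁻¹}

/-- The Bruhat order: generated by `u < u t` for reflections `t` with `l(u) < l(u t)`.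
Since reflections lie in `W'`, elements with different components in `Ω` are not comparable. -/
def bruhatLE {r : ℕ} : W r → W r → Prop :=
  Relation.ReflTransGen (fun u v => (∃ t ∈ reflections r, v = u * t) ∧ len u < len v)

/-! ### The extended affine Hecke algebra -/

/-- `𝓐 = ℤ[t, t⁻¹]`. -/
abbrev 𝓐 : Type := ℤ[T;T⁻¹]

/-- `tpow m = t ^ m`. -/
def tpow (m : ℤ) : 𝓐 := LaurentPolynomial.T m

/-- `q = t²`. -/
def q : 𝓐 := tpow 2

/-- The defining relations of the Hecke algebra on generators `T_w`, `w ∈ W`. -/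
inductive HeckeRel (r : ℕ) : FreeAlgebra 𝓐 (W r) → FreeAlgebra 𝓐 (W r) → Prop
  | one : HeckeRel r (FreeAlgebra.ι 𝓐 (1 : W r)) 1
  | mul (w w' : W r) (h : len (w * w') = len w + len w') :
      HeckeRel r (FreeAlgebra.ι 𝓐 w * FreeAlgebra.ι 𝓐 w') (FreeAlgebra.ι 𝓐 (w * w'))
  | quad (s : W r) (hs : s ∈ simpleRefl r) :
      HeckeRel r ((FreeAlgebra.ι 𝓐 s + 1) * (FreeAlgebra.ι 𝓐 s - algebraMap 𝓐 _ q)) 0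

/-- The extended affine Hecke algebra, by generators `T_w` (`w ∈ W`) and relations. -/
def Hecke (r : ℕ) : Type := RingQuot (HeckeRel r)

instance (r : ℕ) : Ring (Hecke r) := inferInstanceAs (Ring (RingQuot (HeckeRel r)))

instance (r : ℕ) : Algebra 𝓐 (Hecke r) := inferInstanceAs (Algebra 𝓐 (RingQuot (HeckeRel r)))

/-- The standard basis element `T_w`. -/
def T {r : ℕ} (w : W r) : Hecke r := RingQuot.mkAlgHom 𝓐 (HeckeRel r) (FreeAlgebra.ι 𝓐 w)

/-- `T_X`, the sum of the `T_x` for `x` in a finite set `X ⊆ W`. -/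
def TSum {r : ℕ} (X : Set (W r)) : Hecke r := ∑ᶠ x ∈ X, T x

/-- `f` is the bar involution: the ring endomorphism with `t ↦ t⁻¹` and `T_w ↦ (T_{w⁻¹})⁻¹`. -/
def IsBar {r : ℕ} (f : Hecke r →+* Hecke r) : Prop :=
  (∀ a : 𝓐, f (algebraMap 𝓐 (Hecke r) a) =
    algebraMap 𝓐 (Hecke r) (LaurentPolynomial.invert a)) ∧
  ∀ w : W r, f (T w) = Ring.inverse (T w⁻¹)

/-- The bar involution of the Hecke algebra. -/
def bar (r : ℕ) : Hecke r →+* Hecke r := theUnique (RingHom.id _) IsBar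

/-- The properties that characterize the Kazhdan-Lusztig element `C_w`: it is fixed by the bar
involution and equals `q^{-l(w)/2} ∑_{y ≤ w} P_{y,w}(q) T_y`, where `P_{w,w} = 1` and `P_{y,w}` is
a polynomial of degree at most `(l(w) - l(y) - 1)/2` for `y < w`. -/
def IsKL {r : ℕ} (w : W r) (C : Hecke r) : Prop :=
  bar r C = C ∧ ∃ P : W r → Polynomial ℤ, P w = 1 ∧
    (∀ y, bruhatLE y w → y ≠ w → 2 * (P y).natDegree + len y + 1 ≤ len w) ∧
    C = tpow (-(len w : ℤ)) • ∑ᶠ y ∈ {y | bruhatLE y w}, (Polynomial.aeval q (P y)) • T y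

/-- The Kazhdan-Lusztig basis element `C_w`. -/
def C {r : ℕ} (w : W r) : Hecke r := theUnique 0 (IsKL w)

/-! ### Compositions, Young subgroups and double cosets -/

/-- `Λ(n,r)`: the `n`-periodic families of natural numbers `(λ_i)_{i ∈ ℤ}` with
`λ_1 + ⋯ + λ_n = r`. -/
def Lam (n r : ℕ) : Type :=
  {l : ℤ → ℕ // (∀ i, l i = l (i - n)) ∧ ∑ i ∈ Finset.Icc (1 : ℤ) n, l i = r}

/-- The subset `I(λ)` of `S_0 = {s_1, …, s_{r-1}}`: all `s_i` for which `i` is none of the partial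
sums `λ_1 + ⋯ + λ_k`, `1 ≤ k ≤ n`. -/
def simpleSubset {n r : ℕ} (l : Lam n r) : Set (W r) :=
  {s | ∃ i : ℤ, 1 ≤ i ∧ i < r ∧ IsSimple r i s ∧
    ∀ k : ℤ, 1 ≤ k → k ≤ n → i ≠ ∑ j ∈ Finset.Icc (1 : ℤ) k, (l.1 j : ℤ)}

/-- The standard Young subgroup `W_λ`. -/
def young {n r : ℕ} (l : Lam n r) : Subgroup (W r) := Subgroup.closure (simpleSubset l)

/-- The double coset `W_λ w W_μ`. -/
def dcoset {n r : ℕ} (l m : Lam n r) (w : W r) : Set (W r) :=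
  DoubleCoset.doubleCoset w (young l : Set (W r)) (young m : Set (W r))

/-- `D_{λμ}`: the elements of minimal length in their double coset `W_λ w W_μ`. -/
def minReps {n r : ℕ} (l m : Lam n r) : Set (W r) :=
  {w | ∀ y ∈ dcoset l m w, len w ≤ len y}

/-- The element of maximal length of a subset of `W` (if there is exactly one). -/
def longest {r : ℕ} (X : Set (W r)) : W r :=
  theUnique 1 (fun x => x ∈ X ∧ ∀ y ∈ X, len y ≤ len x)

/-- `w⁺`, the longest element of `W_λ w W_μ`. -/
def plus {n r : ℕ} (l m : Lam n r) (w : W r) : W r := longest (dcoset l m w)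

/-- `w_{0,μ}`, the longest element of `W_μ`. -/
def w0 {n r : ℕ} (m : Lam n r) : W r := longest (young m : Set (W r))

/-! ### The affine `q`-Schur algebra -/

/-- `x_λ`, the sum of the `T_w` for `w ∈ W_λ`. -/
def xElt {n r : ℕ} (l : Lam n r) : Hecke r := TSum (young l : Set (W r))

/-- The right ideal `x_λ H`, as a right `H`-module (a module over the opposite ring). -/
def xIdeal {n r : ℕ} (l : Lam n r) : Submodule (Hecke r)ᵐᵒᵖ (Hecke r) where
  carrier := {y | ∃ h, y = xElt l * h}
  add_mem' := by
    rintro _ _ ⟨a, rfl⟩ ⟨b, rfl⟩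
    exact ⟨a + b, (mul_add _ _ _).symm⟩
  zero_mem' := ⟨0, (mul_zero _).symm⟩
  smul_mem' := by
    rintro c _ ⟨a, rfl⟩
    exact ⟨a * c.unop, mul_assoc _ _ _⟩

/-- The right `H`-module `⨁_λ x_λ H`. -/
abbrev XSum (n r : ℕ) : Type := ⨁ l : Lam n r, xIdeal l

/-- The affine `q`-Schur algebra `End_H (⨁_λ x_λ H)`. -/
abbrev Schur (n r : ℕ) : Type := Module.End (Hecke r)ᵐᵒᵖ (XSum n r)

/-- The inclusion `x_λ H → ⨁_ν x_ν H`. -/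
def incl {n r : ℕ} (l : Lam n r) : xIdeal l →ₗ[(Hecke r)ᵐᵒᵖ] XSum n r :=
  open Classical in DirectSum.lof (Hecke r)ᵐᵒᵖ (Lam n r) (fun l => xIdeal l) l

/-- The projection `⨁_ν x_ν H → x_λ H`. -/
def proj {n r : ℕ} (l : Lam n r) : XSum n r →ₗ[(Hecke r)ᵐᵒᵖ] xIdeal l :=
  DirectSum.component (Hecke r)ᵐᵒᵖ (Lam n r) (fun l => xIdeal l) l

/-- `f` is the endomorphism that maps `x_μ h` to `T_{W_λ w W_μ} h` in the summand `x_λ H` and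
kills `x_ν h` for `ν ≠ μ`; this is expressed by the components of `f (x_ν h)`. -/
def IsPhi {n r : ℕ} (l m : Lam n r) (w : W r) (f : Schur n r) : Prop :=
  open Classical in
  ∀ (v : Lam n r) (h : Hecke r) (k : Lam n r),
    (proj k (f (incl v ⟨xElt v * h, h, rfl⟩)) : Hecke r) =
      if v = m ∧ k = l then TSum (dcoset l m w) * h else 0

/-- The standard basis element `φ_{λμ}^w`. -/
def phi {n r : ℕ} (l m : Lam n r) (w : W r) : Schur n r := theUnique 0 (IsPhi l m w)

/-- The coefficients `α_{z,w}`, `z ∈ D_{λμ}`, in `C_{w⁺} = ∑_z α_{z,w} T_{W_λ z W_μ}`. -/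
def alpha {n r : ℕ} (l m : Lam n r) (w : W r) : minReps l m →₀ 𝓐 :=
  theUnique 0 (fun a => C (plus l m w) = a.sum (fun z c => c • TSum (dcoset l m z.1)))

/-- The index set of the triples `B = (λ, w_B, μ)` with `w_B ∈ D_{λμ}`. -/
structure Triple (n r : ℕ) where
  lam : Lam n r
  mu : Lam n r
  w : W r
  mem : w ∈ minReps lam mu

/-- `θ_B = t^{l(w_{0,μ})} ∑_z α_{z,w_B} φ_{λμ}^z`. -/
def theta {n r : ℕ} (B : Triple n r) : Schur n r :=
  tpow (len (w0 B.mu)) •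
    (alpha B.lam B.mu B.w).sum (fun z c => c • phi B.lam B.mu z.1)

end AffineSchur

end

noncomputable section

set_option linter.unusedSectionVars false

namespace AffineSchur

/-! ### Affine permutations -/

section Permutations

variable {r : ℕ}

/-! An endomorphism of the sum of the modules `x_λ H` is determined by the components `val v k f` in
`x_k H` of the images of the generators `x_v` (`val_ext`). For `s` in `W_λ` one has `T_s x_λ = q x_λ
= x_λ T_s`, so each component `h` satisfies `T_s h = q h` for `s` in `W_k` and `h T_s = q h` for `s`
in `W_v`. The first equation makes the coefficients of `h` at `w` and `s w` equal, the second does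
the same for `w` and `w s`; hence `h` is constant on double cosets (`val_mem_biInvariant`).
Conversely, an element of `biInvariant l m` lies both in `x_l H` and in `H x_m`. Writing it as `g
x_m`, left multiplication by `g` is a map `x_m H → x_l H` with that value on the generator
(`exists_mulMap`). Under this correspondence `φ^z` becomes the double coset sum and `θ_B` becomes a
power of `t` times `C_{w_B⁺}` (`val_theta`).

So (1) amounts to the `C_{w⁺}` forming a basis of `biInvariant l m`. They belong to it because every
simple reflection of the two Young subgroups is a descent of `w⁺`, which makes `C_{w⁺}` an
eigenvector (`T_mul_C`, `C_mul_T`). They form a basis because the passage from the double coset sums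
is triangular for the Bruhat order on the elements `w⁺`, with powers of `t` on the diagonal. For
(2), `C_{w_{0,μ}} = t^{-l(w_{0,μ})} x_μ` (`C_w0`), and the power of `t` in `θ_B` cancels.

The objects in the statement are given by minima, relations and unique existence, so their theory
has to be established: the exchange property through explicit permutations (`len_lt_mul_refl_iff`),
unique shortest and longest elements of double cosets (`reducedFrom_of_extremal`), the standard
basis (`TBasis`), the bar involution (`existsUnique_isBar`) and the Kazhdan–Lusztig elements
(`existsUnique_isKL`). -/

lemma mul_val_apply (a b : W r) (j : ℤ) : (a * b).1 j = a.1 (b.1 j) := rfl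

lemma one_val_apply (j : ℤ) : (1 : W r).1 j = j := rfl

lemma val_inv_apply (w : W r) (j : ℤ) : w.1 (w⁻¹.1 j) = j := w.1.apply_symm_apply j

lemma W_ext {a b : W r} (h : ∀ j, a.1 j = b.1 j) : a = b := Subtype.ext (Equiv.ext h)

lemma val_inj (w : W r) {a b : ℤ} : w.1 a = w.1 b ↔ a = b := w.1.injective.eq_iff

lemma val_add (w : W r) (i : ℤ) : w.1 (i + r) = w.1 i + r := w.2 i

lemma val_add_mul (w : W r) (i k : ℤ) : w.1 (i + r * k) = w.1 i + r * k := by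
  induction k with
  | zero => simp
  | succ k ih => rw [mul_add, ← add_assoc, mul_one, val_add, ih]; ring
  | pred k ih =>
    have := val_add w (i + r * (-(k : ℤ) - 1))
    rw [show i + (r : ℤ) * (-(k : ℤ) - 1) + r = i + r * (-(k : ℤ)) by ring, ih] at this
    linarith

lemma val_of_modEq (w : W r) {a b : ℤ} (h : b ≡ a [ZMOD r]) : w.1 b = w.1 a + (b - a) := by
  obtain ⟨k, hk⟩ := h.symm.dvd
  have : b = a + r * k := by linarith
  rw [this, val_add_mul]; ring

lemma val_modEq (w : W r) {a b : ℤ} (h : a ≡ b [ZMOD r]) : w.1 a ≡ w.1 b [ZMOD r] := by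
  rw [val_of_modEq w h]
  have := Int.ModEq.add_left (w.1 b) (Int.ModEq.sub_right b h)
  simpa using this

lemma shift_val_apply (j : ℤ) : (shift r).1 j = j + 1 := rfl

lemma shift_zpow_apply (k j : ℤ) : (shift r ^ k).1 j = j + k := by
  induction k generalizing j with
  | zero => simp
  | succ k ih => rw [zpow_add_one, mul_val_apply, ih, shift_val_apply]; ring
  | pred k ih =>
    have h : (shift r)⁻¹.1 j = j - 1 := by
      rw [← val_inj (shift r), val_inv_apply, shift_val_apply]; ring
    rw [zpow_sub_one, mul_val_apply, h, ih]; ring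

/-- `t` is the affine transposition that interchanges `a + k r` and `b + k r` for all `k`. -/
def IsRefl (a b : ℤ) (t : W r) : Prop :=
  ∀ j : ℤ, (j ≡ a [ZMOD r] → t.1 j = j + (b - a)) ∧ (j ≡ b [ZMOD r] → t.1 j = j - (b - a)) ∧
    (¬ j ≡ a [ZMOD r] → ¬ j ≡ b [ZMOD r] → t.1 j = j)

lemma isSimple_iff_isRefl {i : ℤ} {s : W r} : IsSimple r i s ↔ IsRefl i (i + 1) s := by
  simp [IsSimple, IsRefl]

namespace IsRefl

lemma apply_left {a b : ℤ} {t : W r} (h : IsRefl a b t) : t.1 a = b := by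
  rw [(h a).1 rfl]; ring

lemma apply_right {a b : ℤ} {t : W r} (h : IsRefl a b t) : t.1 b = a := by
  rw [(h b).2.1 rfl]; ring

lemma unique {a b : ℤ} {t t' : W r} (h : IsRefl a b t) (h' : IsRefl a b t') : t = t' := by
  refine W_ext fun j => ?_
  by_cases h1 : j ≡ a [ZMOD r]
  · rw [(h j).1 h1, (h' j).1 h1]
  by_cases h2 : j ≡ b [ZMOD r]
  · rw [(h j).2.1 h2, (h' j).2.1 h2]
  rw [(h j).2.2 h1 h2, (h' j).2.2 h1 h2]

lemma symm {a b : ℤ} {t : W r} (h : IsRefl a b t) : IsRefl b a t := fun j =>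
  ⟨fun h1 => by rw [(h j).2.1 h1]; ring, fun h1 => by rw [(h j).1 h1]; ring,
    fun h1 h2 => (h j).2.2 h2 h1⟩

lemma of_modEq {a b a' b' : ℤ} {t : W r} (h : IsRefl a b t) (h1 : a' ≡ a [ZMOD r])
    (h2 : b' - a' = b - a) : IsRefl a' b' t := by
  have h3 : b' ≡ b [ZMOD r] := by
    have := h1.add_right (b - a)
    rwa [← h2, show a' + (b' - a') = b' by ring, h2, show a + (b - a) = b by ring] at this
  refine fun j => ⟨fun h4 => ?_, fun h4 => ?_, fun h4 h5 => ?_⟩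
  · rw [h2, (h j).1 (h4.trans h1)]
  · rw [h2, (h j).2.1 (h4.trans h3)]
  · exact (h j).2.2 (fun h6 => h4 (h6.trans h1.symm)) (fun h6 => h5 (h6.trans h3.symm))

lemma conj {a b : ℤ} {t : W r} (h : IsRefl a b t) (x : W r) :
    IsRefl (x.1 a) (x.1 b) (x * t * x⁻¹) := by
  have key : ∀ (j c : ℤ), j ≡ x.1 c [ZMOD r] → x⁻¹.1 j ≡ c [ZMOD r] := fun j c hj => by
    simpa using val_modEq x⁻¹ hj
  have key' : ∀ (j c : ℤ), x⁻¹.1 j ≡ c [ZMOD r] → j ≡ x.1 c [ZMOD r] := fun j c hj => by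
    simpa using val_modEq x hj
  refine fun j => ⟨fun h1 => ?_, fun h1 => ?_, fun h1 h2 => ?_⟩
  · have h2 := key _ _ h1
    have h3 := val_of_modEq x h2
    rw [val_inv_apply] at h3
    have h4 : x⁻¹.1 j + (b - a) ≡ b [ZMOD r] := by
      simpa using h2.add_right (b - a)
    rw [mul_val_apply, mul_val_apply, (h _).1 h2, val_of_modEq x h4]
    linarith
  · have h2 := key _ _ h1
    have h3 := val_of_modEq x h2
    rw [val_inv_apply] at h3
    have h4 : x⁻¹.1 j - (b - a) ≡ a [ZMOD r] := by
      simpa using h2.sub_right (b - a)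
    rw [mul_val_apply, mul_val_apply, (h _).2.1 h2, val_of_modEq x h4]
    linarith
  · rw [mul_val_apply, mul_val_apply, (h _).2.2 (fun h3 => h1 (key' _ _ h3))
      (fun h3 => h2 (key' _ _ h3)), val_inv_apply]

lemma mul_self {a b : ℤ} {t : W r} (h : IsRefl a b t) : t * t = 1 := by
  refine W_ext fun j => ?_
  rw [mul_val_apply, one_val_apply]
  by_cases h2 : j ≡ a [ZMOD r]
  · rw [(h j).1 h2, (h _).2.1 (by simpa using h2.add_right (b - a))]; ring
  by_cases h3 : j ≡ b [ZMOD r]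
  · rw [(h j).2.1 h3, (h _).1 (by simpa using h3.sub_right (b - a))]; ring
  rw [(h j).2.2 h2 h3, (h j).2.2 h2 h3]

lemma inv_eq {a b : ℤ} {t : W r} (h : IsRefl a b t) : t⁻¹ = t :=
  inv_eq_of_mul_eq_one_left h.mul_self

/-- `x t x⁻¹ = t'` for the transpositions `t`, `t'` of `a, b` and `x a, x b`. -/
lemma mul_eq_mul {a b : ℤ} {t t' x : W r} (h : IsRefl a b t) (h' : IsRefl (x.1 a) (x.1 b) t') :
    x * t = t' * x := by
  rw [← (h.conj x).unique h', inv_mul_cancel_right]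

end IsRefl

namespace IsSimple

lemma isRefl {i p : ℤ} {s : W r} (h : IsSimple r i s) (hp : p ≡ i [ZMOD r]) :
    IsRefl p (p + 1) s :=
  (isSimple_iff_isRefl.1 h).of_modEq hp (by ring)

lemma of_modEq {i p : ℤ} {s : W r} (h : IsSimple r i s) (hp : p ≡ i [ZMOD r]) :
    IsSimple r p s := isSimple_iff_isRefl.2 (h.isRefl hp)

lemma mul_self {i : ℤ} {s : W r} (h : IsSimple r i s) : s * s = 1 :=
  (h.isRefl rfl).mul_self

lemma inv_eq {i : ℤ} {s : W r} (h : IsSimple r i s) : s⁻¹ = s := (h.isRefl rfl).inv_eq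

/-- A simple reflection reverses only the pairs `(p, p + 1)` with `p ≡ i`. -/
lemma flip {i p q : ℤ} {s : W r} (h : IsSimple r i s) (hpq : p < q) (hs : s.1 q < s.1 p) :
    p ≡ i [ZMOD r] ∧ q = p + 1 := by
  have cases : ∀ j, (j ≡ i [ZMOD r] ∧ s.1 j = j + 1) ∨ s.1 j = j - 1 ∨ s.1 j = j := fun j => by
    by_cases h1 : j ≡ i [ZMOD r]
    · exact Or.inl ⟨h1, (h j).1 h1⟩
    by_cases h2 : j ≡ i + 1 [ZMOD r]
    · exact Or.inr (Or.inl ((h j).2.1 h2))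
    exact Or.inr (Or.inr ((h j).2.2 h1 h2))
  rcases cases p with ⟨hp, hp'⟩ | hp' | hp' <;> rcases cases q with ⟨hq, hq'⟩ | hq' | hq' <;>
    first | omega | exact ⟨hp, by omega⟩

end IsSimple

lemma mem_simpleRefl_iff [NeZero r] {s : W r} : s ∈ simpleRefl r ↔ ∃ i, IsSimple r i s := by
  refine ⟨fun ⟨i, _, _, h⟩ => ⟨i, h⟩, fun ⟨i, h⟩ => ?_⟩
  have hr : (0 : ℤ) < r := by exact_mod_cast Nat.pos_of_ne_zero (NeZero.ne r)
  exact ⟨i % r, Int.emod_nonneg _ hr.ne', Int.emod_lt_of_pos _ hr,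
    h.of_modEq (Int.mod_modEq _ _)⟩

lemma exists_isSimple (hr : 2 ≤ r) (i : ℤ) : ∃ s : W r, IsSimple r i s := by
  have hne : ∀ j : ℤ, j ≡ i [ZMOD r] → ¬ j ≡ i + 1 [ZMOD r] := fun j h1 h2 => by
    have h3 := (h1.symm.trans h2).dvd
    have : (r : ℤ) ∣ 1 := by simpa using h3
    have := Int.le_of_dvd one_pos this
    omega
  let f : ℤ → ℤ := fun j =>
    if j ≡ i [ZMOD r] then j + 1 else if j ≡ i + 1 [ZMOD r] then j - 1 else j
  have hf : Function.Involutive f := fun j => by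
    by_cases h1 : j ≡ i [ZMOD r]
    · have h2 : j + 1 ≡ i + 1 [ZMOD r] := h1.add_right 1
      have h3 : ¬ j + 1 ≡ i [ZMOD r] := fun h => hne _ h h2
      simp [f, h1, h2, h3]
    by_cases h2 : j ≡ i + 1 [ZMOD r]
    · have h3 : j - 1 ≡ i [ZMOD r] := by simpa using h2.sub_right 1
      simp [f, h1, h2, h3]
    simp [f, h1, h2]
  have hadd : ∀ j, f (j + r) = f j + r := fun j => by
    have h : ∀ c : ℤ, j + r ≡ c [ZMOD r] ↔ j ≡ c [ZMOD r] := fun c => by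
      simp [Int.ModEq]
    simp only [f, h]
    split_ifs <;> ring
  refine ⟨⟨hf.toPerm, hadd⟩, fun j => ⟨fun h => ?_, fun h => ?_, fun h h' => ?_⟩⟩
  · show f j = _
    simp [f, h]
  · have h1 : ¬ j ≡ i [ZMOD r] := fun h1 => hne _ h1 h
    show f j = _
    simp [f, h, h1]
  · show f j = _
    simp [f, h, h']

/-- An increasing affine permutation is a power of the shift. -/
lemma eq_shift_zpow {w : W r} (h : ∀ i, w.1 i < w.1 (i + 1)) : ∃ k : ℤ, w = shift r ^ k := by
  have hmono : StrictMono w.1 := strictMono_int_of_lt_succ h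
  have hs : ∀ i, w.1 (i + 1) = w.1 i + 1 := fun i => by
    by_contra hne
    have h1 : w.1 i + 1 < w.1 (i + 1) := lt_of_le_of_ne (h i) (Ne.symm hne)
    obtain ⟨j, hj⟩ := w.1.surjective (w.1 i + 1)
    rw [← hj] at h1
    have h2 : w.1 i < w.1 j := by omega
    have := hmono.lt_iff_lt.1 h1
    have := hmono.lt_iff_lt.1 h2
    omega
  refine ⟨w.1 0, W_ext fun j => ?_⟩
  rw [shift_zpow_apply]
  induction j with
  | zero => simp
  | succ k ih => rw [hs, ih]; ring
  | pred k ih =>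
    have := hs (-(k : ℤ) - 1)
    rw [sub_add_cancel, ih] at this
    linarith

/-- A place where `w` decreases exists by `eq_shift_zpow`. It forces `r ≥ 2`, since for `r = 1` one
has `w (i + 1) = w i + 1`; hence the simple reflection at that place exists. -/
lemma exists_descent_of_ne [NeZero r] {w : W r} (h : ∀ k : ℤ, w ≠ shift r ^ k) :
    ∃ i s, IsSimple r i s ∧ w.1 (i + 1) < w.1 i := by
  by_contra! hc
  have hr : ∀ i, w.1 (i + 1) < w.1 i → 2 ≤ r := fun i hi => by
    by_contra hr
    obtain rfl : r = 1 := by have := NeZero.ne r; omega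
    have := val_add w i
    push_cast at this
    omega
  obtain ⟨k, hk⟩ := eq_shift_zpow (w := w) fun i => by
    by_contra hi
    have hi : w.1 (i + 1) < w.1 i := lt_of_le_of_ne (not_lt.1 hi) (by simp)
    obtain ⟨s, hs⟩ := exists_isSimple (hr i hi) i
    exact absurd hi (not_lt.2 (hc i s hs))
  exact h k hk

end Permutations

/-! ### Generation by simple reflections and shifts -/

section Generation

variable {r : ℕ}

lemma sum_range_add_periodic {f : ℤ → ℤ} (hf : ∀ j, f (j + r) = f j) (c : ℤ) :
    ∑ j ∈ Finset.range r, f (c + j) = ∑ j ∈ Finset.range r, f j := by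
  have step : ∀ c : ℤ, ∑ j ∈ Finset.range r, f (c + 1 + j) = ∑ j ∈ Finset.range r, f (c + j) := by
    intro c
    have h1 := Finset.sum_range_succ (fun j : ℕ => f (c + j)) r
    have h2 := Finset.sum_range_succ' (fun j : ℕ => f (c + j)) r
    rw [h1, hf] at h2
    simp only [Nat.cast_zero, add_zero] at h2
    rw [add_left_inj] at h2
    rw [h2]
    refine Finset.sum_congr rfl fun j _ => ?_
    push_cast
    congr 1
    ring
  induction c with
  | zero => simp
  | succ k ih => rw [step, ih]
  | pred k ih => rw [← ih, ← step]; simp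

/-- The total squared displacement of an affine permutation over one period. -/
def displacement (w : W r) : ℤ := ∑ j ∈ Finset.range r, (w.1 j - j) ^ 2

lemma displacement_nonneg (w : W r) : 0 ≤ displacement w :=
  Finset.sum_nonneg fun _ _ => sq_nonneg _

lemma displacement_eq (w : W r) (c : ℤ) :
    displacement w = ∑ j ∈ Finset.range r, (w.1 (c + j) - (c + j)) ^ 2 :=
  (sum_range_add_periodic (f := fun j => (w.1 j - j) ^ 2)
    (fun j => by simp only [val_add]; ring) c).symm

/-- Exchanging the values at `i` and `i + 1` changes the sum of squares by `2 (w (i + 1) - w i) <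
0`. This is the termination measure for sorting `w` into a power of the shift in `exists_word`. -/
lemma displacement_mul_lt {i : ℤ} {w s : W r} (hr : 2 ≤ r) (hs : IsSimple r i s)
    (h : w.1 (i + 1) < w.1 i) : displacement (w * s) < displacement w := by
  obtain ⟨m, rfl⟩ := Nat.exists_eq_add_of_le' hr
  rw [displacement_eq _ i, displacement_eq w i, Finset.sum_range_succ', Finset.sum_range_succ',
    Finset.sum_range_succ', Finset.sum_range_succ']
  have hfix : ∀ j ∈ Finset.range m, (w * s).1 (i + ((j + 1 + 1 : ℕ) : ℤ)) =
      w.1 (i + ((j + 1 + 1 : ℕ) : ℤ)) := fun j hj => by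
    have hj := Finset.mem_range.1 hj
    rw [mul_val_apply, (hs _).2.2]
    · intro h
      have := (Int.modEq_iff_dvd.1 h.symm)
      have := Int.le_of_dvd (by push_cast; omega) this
      push_cast at this
      omega
    · intro h
      have := (Int.modEq_iff_dvd.1 h.symm)
      have := Int.le_of_dvd (by push_cast; omega) this
      push_cast at this
      omega
  rw [Finset.sum_congr rfl fun j hj => by rw [hfix j hj]]
  have h1 : (w * s).1 (i + ((0 : ℕ) : ℤ)) = w.1 (i + 1) := by
    simp [(hs.isRefl rfl).apply_left]
  have h2 : (w * s).1 (i + ((0 + 1 : ℕ) : ℤ)) = w.1 i := by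
    simp [(hs.isRefl rfl).apply_right]
  rw [h1, h2]
  push_cast
  simp only [add_zero]
  nlinarith

lemma simple_two_le [NeZero r] {i : ℤ} {s : W r} (hs : IsSimple r i s) : 2 ≤ r := by
  by_contra hr
  obtain rfl : r = 1 := by have := NeZero.ne r; omega
  have h1 := (hs i).1 rfl
  have h2 := (hs i).2.1 (by simp)
  omega

lemma exists_word [NeZero r] (w : W r) : ∃ (k : ℤ) (L : List (W r)),
    (∀ s ∈ L, s ∈ simpleRefl r) ∧ w = shift r ^ k * L.prod := by
  induction hd : (displacement w).toNat using Nat.strong_induction_on generalizing w with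
  | _ d ih =>
    by_cases hw : ∃ k : ℤ, w = shift r ^ k
    · obtain ⟨k, rfl⟩ := hw
      exact ⟨k, [], by simp, by simp⟩
    push Not at hw
    obtain ⟨i, s, hs, hi⟩ := exists_descent_of_ne hw
    have hlt := displacement_mul_lt (simple_two_le hs) hs hi
    have := displacement_nonneg (w * s)
    obtain ⟨k, L, hL, h⟩ := ih _ (by omega) (w * s) rfl
    refine ⟨k, L ++ [s], ?_, ?_⟩
    · intro t ht
      rcases List.mem_append.1 ht with ht | ht
      · exact hL t ht
      · rw [List.mem_singleton.1 ht]
        exact mem_simpleRefl_iff.2 ⟨i, hs⟩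
    · rw [List.prod_append, List.prod_singleton, ← mul_assoc, ← h, mul_assoc, hs.mul_self, mul_one]

end Generation

/-! ### The length function -/

section Length

variable {r : ℕ} [NeZero r]

lemma len_le_of_word {w : W r} {k : ℤ} {L : List (W r)} (hL : ∀ s ∈ L, s ∈ simpleRefl r)
    (h : w = shift r ^ k * L.prod) : len w ≤ L.length :=
  Nat.sInf_le ⟨k, L, hL, h, rfl⟩

lemma exists_reduced_word (w : W r) : ∃ (k : ℤ) (L : List (W r)),
    (∀ s ∈ L, s ∈ simpleRefl r) ∧ w = shift r ^ k * L.prod ∧ L.length = len w := by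
  obtain ⟨k, L, hL, h⟩ := exists_word w
  exact Nat.sInf_mem (s := {m | ∃ (k : ℤ) (L : List (W r)), (∀ s ∈ L, s ∈ simpleRefl r) ∧
    w = shift r ^ k * L.prod ∧ L.length = m}) ⟨_, k, L, hL, h, rfl⟩

lemma len_shift_zpow (k : ℤ) : len (shift r ^ k) = 0 :=
  Nat.le_zero.1 (len_le_of_word (k := k) (L := []) (by simp) (by simp))

lemma len_one : len (1 : W r) = 0 := by simpa using len_shift_zpow (r := r) 0

lemma len_shift_mul (k : ℤ) (w : W r) : len (shift r ^ k * w) = len w := by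
  have key : ∀ (k : ℤ) (w : W r), len (shift r ^ k * w) ≤ len w := fun k w => by
    obtain ⟨m, L, hL, h, hl⟩ := exists_reduced_word w
    rw [← hl]
    exact len_le_of_word (k := k + m) hL (by rw [h, zpow_add, mul_assoc])
  refine le_antisymm (key k w) ?_
  simpa using key (-k) (shift r ^ k * w)

lemma simple_conj_shift (k : ℤ) {s : W r} (hs : s ∈ simpleRefl r) :
    (shift r ^ k) * s * (shift r ^ k)⁻¹ ∈ simpleRefl r := by
  obtain ⟨i, hi⟩ := mem_simpleRefl_iff.1 hs
  refine mem_simpleRefl_iff.2 ⟨i + k, isSimple_iff_isRefl.2 ?_⟩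
  have := (hi.isRefl rfl).conj (shift r ^ k)
  rw [shift_zpow_apply, shift_zpow_apply] at this
  convert this using 1
  ring

/-- Conjugation by the shift permutes the simple reflections, so powers of the shift move across a
word without changing its number of letters. Hence `len` is subadditive and invariant under
inversion on all of `W`. -/
lemma word_mul_shift (k : ℤ) (L : List (W r)) (hL : ∀ s ∈ L, s ∈ simpleRefl r) :
    ∃ L' : List (W r), (∀ s ∈ L', s ∈ simpleRefl r) ∧ L'.length = L.length ∧
      L.prod * shift r ^ k = shift r ^ k * L'.prod := by
  induction L with
  | nil => exact ⟨[], by simp, rfl, by simp⟩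
  | cons s L ih =>
    obtain ⟨L', h1, h2, h3⟩ := ih fun t ht => hL t (List.mem_cons_of_mem _ ht)
    refine ⟨((shift r ^ (-k)) * s * (shift r ^ (-k))⁻¹) :: L', ?_, by simp [h2], ?_⟩
    · intro t ht
      rcases List.mem_cons.1 ht with rfl | ht
      · exact simple_conj_shift _ (hL s List.mem_cons_self)
      · exact h1 t ht
    · rw [List.prod_cons, List.prod_cons, mul_assoc, h3, zpow_neg]
      group

lemma len_mul_le (u v : W r) : len (u * v) ≤ len u + len v := by
  obtain ⟨k, L, hL, hu, hl⟩ := exists_reduced_word u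
  obtain ⟨m, L', hL', hv, hl'⟩ := exists_reduced_word v
  obtain ⟨L'', h1, h2, h3⟩ := word_mul_shift m L hL
  rw [← hl, ← hl', ← h2, ← List.length_append]
  refine len_le_of_word (k := k + m) ?_ ?_
  · intro s hs
    rcases List.mem_append.1 hs with hs | hs
    exacts [h1 s hs, hL' s hs]
  · rw [hu, hv, List.prod_append, zpow_add]
    calc shift r ^ k * L.prod * (shift r ^ m * L'.prod)
        = shift r ^ k * (L.prod * shift r ^ m) * L'.prod := by group
      _ = _ := by rw [h3]; group

lemma simple_inv {s : W r} (hs : s ∈ simpleRefl r) : s⁻¹ = s := by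
  obtain ⟨i, hi⟩ := mem_simpleRefl_iff.1 hs
  exact hi.inv_eq

lemma simple_mul_self {s : W r} (hs : s ∈ simpleRefl r) : s * s = 1 := by
  obtain ⟨i, hi⟩ := mem_simpleRefl_iff.1 hs
  exact hi.mul_self

lemma simple_mul_cancel {s : W r} (hs : s ∈ simpleRefl r) (w : W r) : s * (s * w) = w := by
  rw [← mul_assoc, simple_mul_self hs, one_mul]

lemma mul_simple_cancel {s : W r} (hs : s ∈ simpleRefl r) (w : W r) : w * s * s = w := by
  rw [mul_assoc, simple_mul_self hs, mul_one]

lemma len_inv (w : W r) : len w⁻¹ = len w := by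
  have key : ∀ w : W r, len w⁻¹ ≤ len w := fun w => by
    obtain ⟨k, L, hL, hw, hl⟩ := exists_reduced_word w
    have hrev : L.prod⁻¹ = L.reverse.prod := by
      rw [List.prod_inv_reverse]
      congr 2
      conv_rhs => rw [← List.map_id L]
      exact List.map_congr_left fun s hs => simple_inv (hL s hs)
    obtain ⟨L', h1, h2, h3⟩ := word_mul_shift (-k) L.reverse fun s hs => hL s (by simpa using hs)
    rw [← hl, ← List.length_reverse, ← h2]
    refine len_le_of_word (k := -k) h1 ?_
    rw [hw, mul_inv_rev, hrev, ← zpow_neg, h3]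
  exact le_antisymm (key w) (by simpa using key w⁻¹)

lemma len_simple_le {s : W r} (hs : s ∈ simpleRefl r) : len s ≤ 1 :=
  len_le_of_word (k := 0) (L := [s]) (by simpa using hs) (by simp)

/-- Let the letters act from right to left on the pair `a < b`. The first letter that reverses the
order of the two images is a simple reflection, hence interchanges exactly these two images, and
multiplication by `t` deletes it. -/
lemma word_mul_refl {a b : ℤ} {t : W r} (ht : IsRefl a b t) (hab : a < b) (L : List (W r))
    (hL : ∀ s ∈ L, s ∈ simpleRefl r) (hlt : L.prod.1 b < L.prod.1 a) :
    ∃ L' : List (W r), (∀ s ∈ L', s ∈ simpleRefl r) ∧ L'.length < L.length ∧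
      L.prod * t = L'.prod := by
  induction L with
  | nil => exact absurd hlt (not_lt.2 (by simpa [one_val_apply] using hab.le))
  | cons s L ih =>
    have hL' : ∀ s ∈ L, s ∈ simpleRefl r := fun t ht => hL t (List.mem_cons_of_mem _ ht)
    rcases lt_trichotomy (L.prod.1 b) (L.prod.1 a) with h | h | h
    · obtain ⟨L', h1, h2, h3⟩ := ih hL' h
      refine ⟨s :: L', ?_, by simpa using h2, ?_⟩
      · intro t ht
        rcases List.mem_cons.1 ht with rfl | ht
        exacts [hL _ List.mem_cons_self, h1 t ht]
      · rw [List.prod_cons, List.prod_cons, mul_assoc, h3]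
    · exact absurd (L.prod.1.injective h) hab.ne'
    · obtain ⟨i, hi⟩ := mem_simpleRefl_iff.1 (hL s List.mem_cons_self)
      rw [List.prod_cons, mul_val_apply, mul_val_apply] at hlt
      obtain ⟨h1, h2⟩ := hi.flip h hlt
      refine ⟨L, hL', by simp, ?_⟩
      have := ht.mul_eq_mul (x := L.prod) (t' := s) (h2 ▸ hi.isRefl h1)
      rw [List.prod_cons, mul_assoc, this, simple_mul_cancel (hL s List.mem_cons_self)]

/-- The strong exchange property. -/
lemma len_mul_refl_lt {a b : ℤ} {t u : W r} (ht : IsRefl a b t) (hab : a < b)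
    (h : u.1 b < u.1 a) : len (u * t) < len u := by
  obtain ⟨k, L, hL, hu, hl⟩ := exists_reduced_word u
  have hlt : L.prod.1 b < L.prod.1 a := by
    rw [hu, mul_val_apply, mul_val_apply, shift_zpow_apply, shift_zpow_apply] at h
    omega
  obtain ⟨L', h1, h2, h3⟩ := word_mul_refl ht hab L hL hlt
  rw [← hl]
  exact (len_le_of_word (k := k) h1 (by rw [hu, mul_assoc, h3])).trans_lt h2

lemma len_lt_mul_refl {a b : ℤ} {t u : W r} (ht : IsRefl a b t) (hab : a < b)
    (h : u.1 a < u.1 b) : len u < len (u * t) := by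
  have := len_mul_refl_lt (u := u * t) ht hab
    (by rwa [mul_val_apply, mul_val_apply, ht.apply_left, ht.apply_right])
  rwa [mul_assoc, ht.mul_self, mul_one] at this

/-- The main tool for lengths: comparison of `u` and `u t` becomes comparison of two integers. It
plays the role of positive and negative roots. -/
lemma len_lt_mul_refl_iff {a b : ℤ} {t u : W r} (ht : IsRefl a b t) (hab : a < b) :
    len u < len (u * t) ↔ u.1 a < u.1 b := by
  refine ⟨fun h => ?_, len_lt_mul_refl ht hab⟩
  by_contra hc
  have := len_mul_refl_lt (u := u) ht hab (lt_of_le_of_ne (not_lt.1 hc) (by simp [hab.ne']))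
  omega

lemma len_mul_refl_lt_iff {a b : ℤ} {t u : W r} (ht : IsRefl a b t) (hab : a < b) :
    len (u * t) < len u ↔ u.1 b < u.1 a := by
  refine ⟨fun h => ?_, len_mul_refl_lt ht hab⟩
  by_contra hc
  have := len_lt_mul_refl (u := u) ht hab (lt_of_le_of_ne (not_lt.1 hc) (by simp [hab.ne]))
  omega

lemma len_mul_simple {s : W r} (hs : s ∈ simpleRefl r) (w : W r) :
    len (w * s) = len w + 1 ∨ len (w * s) + 1 = len w := by
  obtain ⟨i, hi⟩ := mem_simpleRefl_iff.1 hs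
  have h1 := len_mul_le w s
  have h2 := len_mul_le (w * s) s
  have h3 := len_simple_le hs
  rw [mul_simple_cancel hs] at h2
  have h4 := len_lt_mul_refl_iff (u := w) (hi.isRefl rfl) (lt_add_one i)
  have h5 := len_mul_refl_lt_iff (u := w) (hi.isRefl rfl) (lt_add_one i)
  have h6 : w.1 i ≠ w.1 (i + 1) := by simp
  omega

lemma len_simple_mul {s : W r} (hs : s ∈ simpleRefl r) (w : W r) :
    len (s * w) = len w + 1 ∨ len (s * w) + 1 = len w := by
  have := len_mul_simple hs w⁻¹
  rwa [← len_inv (w⁻¹ * s), len_inv w, mul_inv_rev, inv_inv, simple_inv hs] at this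

lemma len_simple {s : W r} (hs : s ∈ simpleRefl r) : len s = 1 := by
  have := len_mul_simple hs 1
  rw [one_mul, len_one] at this
  omega

lemma len_lt_mul_simple_iff {i : ℤ} {s : W r} (hi : IsSimple r i s) {w : W r} :
    len w < len (w * s) ↔ w.1 i < w.1 (i + 1) :=
  len_lt_mul_refl_iff (hi.isRefl rfl) (lt_add_one i)

lemma len_lt_simple_mul_iff {i : ℤ} {s : W r} (hi : IsSimple r i s) {w : W r} :
    len w < len (s * w) ↔ w⁻¹.1 i < w⁻¹.1 (i + 1) := by
  rw [← len_lt_mul_simple_iff hi, len_inv, ← len_inv (w⁻¹ * s), mul_inv_rev, inv_inv, hi.inv_eq]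

lemma len_mul_shift (k : ℤ) (w : W r) : len (w * shift r ^ k) = len w := by
  rw [← len_inv, mul_inv_rev, ← zpow_neg, len_shift_mul, len_inv]

lemma exists_right_descent {w : W r} (h : len w ≠ 0) :
    ∃ s ∈ simpleRefl r, len (w * s) + 1 = len w := by
  obtain ⟨i, s, hs, hi⟩ := exists_descent_of_ne (w := w) fun k hk => h (by
    rw [hk, len_shift_zpow])
  have hs' := mem_simpleRefl_iff.2 ⟨i, hs⟩
  refine ⟨s, hs', ?_⟩
  have := len_mul_refl_lt (u := w) (hs.isRefl rfl) (lt_add_one i) hi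
  rcases len_mul_simple hs' w with h | h <;> omega

lemma exists_left_descent {w : W r} (h : len w ≠ 0) :
    ∃ s ∈ simpleRefl r, len (s * w) + 1 = len w := by
  obtain ⟨s, hs, h1⟩ := exists_right_descent (w := w⁻¹) (by rwa [len_inv])
  refine ⟨s, hs, ?_⟩
  rwa [← len_inv (w⁻¹ * s), len_inv w, mul_inv_rev, inv_inv, simple_inv hs] at h1

lemma eq_shift_of_len_eq_zero {w : W r} (h : len w = 0) : ∃ k : ℤ, w = shift r ^ k := by
  obtain ⟨k, L, _, hw, hl⟩ := exists_reduced_word w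
  rw [h, List.length_eq_zero_iff] at hl
  exact ⟨k, by simpa [hl] using hw⟩

/-- Induction on the length by multiplication with simple reflections on the left. -/
lemma len_induction_left {P : W r → Prop} (base : ∀ k : ℤ, P (shift r ^ k))
    (step : ∀ s ∈ simpleRefl r, ∀ w, len (s * w) = len w + 1 → P w → P (s * w)) (w : W r) :
    P w := by
  induction hn : len w generalizing w with
  | zero =>
    obtain ⟨k, rfl⟩ := eq_shift_of_len_eq_zero hn
    exact base k
  | succ n ih =>
    obtain ⟨s, hs, h⟩ := exists_left_descent (w := w) (by omega)
    have := step s hs (s * w) (by rw [simple_mul_cancel hs]; omega) (ih _ (by omega))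
    rwa [simple_mul_cancel hs] at this

lemma len_induction_right {P : W r → Prop} (base : ∀ k : ℤ, P (shift r ^ k))
    (step : ∀ s ∈ simpleRefl r, ∀ w, len (w * s) = len w + 1 → P w → P (w * s)) (w : W r) :
    P w := by
  induction hn : len w generalizing w with
  | zero =>
    obtain ⟨k, rfl⟩ := eq_shift_of_len_eq_zero hn
    exact base k
  | succ n ih =>
    obtain ⟨s, hs, h⟩ := exists_right_descent (w := w) (by omega)
    have := step s hs (w * s) (by rw [mul_simple_cancel hs]; omega) (ih _ (by omega))
    rwa [mul_simple_cancel hs] at this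

/-- Multiplication by `s'` on the right changes whether `s` is a left ascent only if
`s w = w s'`. -/
lemma left_ascent_mul_right {s s' w : W r} (hs : s ∈ simpleRefl r) (hs' : s' ∈ simpleRefl r)
    (h : s * w ≠ w * s') : (len w < len (s * w) ↔ len (w * s') < len (s * (w * s'))) := by
  obtain ⟨i, hi⟩ := mem_simpleRefl_iff.1 hs
  obtain ⟨j, hj⟩ := mem_simpleRefl_iff.1 hs'
  rw [len_lt_simple_mul_iff hi, len_lt_simple_mul_iff hi, mul_inv_rev, hj.inv_eq, mul_val_apply,
    mul_val_apply]
  -- The pair that decides whether `s` is a left ascent is `w⁻¹ i, w⁻¹ (i + 1)`. If `s'` reversed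
  -- it, `s'` would interchange its two members, and conjugation by `w` would give `w s' = s w`.
  have key : ∀ {p p' : ℤ}, IsRefl (w.1 p) (w.1 p') s →
      ¬ (p < p' ∧ s'.1 p' < s'.1 p) := fun {p p'} h1 ⟨h2, h3⟩ => by
    obtain ⟨h4, rfl⟩ := hj.flip h2 h3
    exact h ((hj.isRefl h4).mul_eq_mul h1).symm
  have k1 := key (p := w⁻¹.1 i) (p' := w⁻¹.1 (i + 1))
    (by rw [val_inv_apply, val_inv_apply]; exact hi.isRefl rfl)
  have k2 := key (p' := w⁻¹.1 i) (p := w⁻¹.1 (i + 1))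
    (by rw [val_inv_apply, val_inv_apply]; exact (hi.isRefl rfl).symm)
  have h6 : w⁻¹.1 i ≠ w⁻¹.1 (i + 1) := by simp
  have h7 : s'.1 (w⁻¹.1 i) ≠ s'.1 (w⁻¹.1 (i + 1)) := by simp
  omega

lemma right_ascent_mul_left {s s' w : W r} (hs : s ∈ simpleRefl r) (hs' : s' ∈ simpleRefl r)
    (h : s * w ≠ w * s') : (len w < len (w * s') ↔ len (s * w) < len (s * w * s')) := by
  have h1 : s' * w⁻¹ ≠ w⁻¹ * s := fun h1 => h (by
    have := congrArg (·⁻¹) h1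
    simpa [mul_inv_rev, simple_inv hs, simple_inv hs'] using this.symm)
  have := left_ascent_mul_right hs' hs h1
  rwa [len_inv, ← len_inv (s' * w⁻¹), ← len_inv (w⁻¹ * s), ← len_inv (s' * _), mul_inv_rev,
    mul_inv_rev, mul_inv_rev, mul_inv_rev, inv_inv, simple_inv hs, simple_inv hs'] at this

end Length

/-! ### The Bruhat order -/

section Bruhat

variable {r : ℕ} [NeZero r]

lemma exists_isRefl_of_mem_reflections {t : W r} (ht : t ∈ reflections r) :
    ∃ a b : ℤ, a < b ∧ IsRefl a b t := by
  obtain ⟨x, s, hs, rfl⟩ := ht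
  obtain ⟨i, hi⟩ := mem_simpleRefl_iff.1 hs
  have h := (hi.isRefl rfl).conj x
  rcases lt_trichotomy (x.1 i) (x.1 (i + 1)) with h1 | h1 | h1
  · exact ⟨_, _, h1, h⟩
  · simp at h1
  · exact ⟨_, _, h1, h.symm⟩

lemma simple_mem_reflections {s : W r} (hs : s ∈ simpleRefl r) : s ∈ reflections r :=
  ⟨1, s, hs, by simp⟩

lemma conj_mem_reflections {t : W r} (ht : t ∈ reflections r) (x : W r) :
    x * t * x⁻¹ ∈ reflections r := by
  obtain ⟨y, s, hs, rfl⟩ := ht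
  exact ⟨x * y, s, hs, by group⟩

lemma bruhatLE_refl (w : W r) : bruhatLE w w := Relation.ReflTransGen.refl

lemma bruhatLE.trans {u v w : W r} (h : bruhatLE u v) (h' : bruhatLE v w) : bruhatLE u w :=
  Relation.ReflTransGen.trans h h'

lemma bruhatLE_mul_reflection {u t : W r} (ht : t ∈ reflections r) (h : len u < len (u * t)) :
    bruhatLE u (u * t) := Relation.ReflTransGen.single ⟨⟨t, ht, rfl⟩, h⟩

lemma bruhatLE_simple_mul {u s : W r} (hs : s ∈ simpleRefl r) (h : len u < len (s * u)) :
    bruhatLE u (s * u) := by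
  have := bruhatLE_mul_reflection (u := u) (conj_mem_reflections (simple_mem_reflections hs) u⁻¹)
    (by rwa [inv_inv, show u * (u⁻¹ * s * u) = s * u by group])
  rwa [inv_inv, show u * (u⁻¹ * s * u) = s * u by group] at this

lemma bruhatLE.len_le {u v : W r} (h : bruhatLE u v) : len u ≤ len v := by
  induction h with
  | refl => exact le_rfl
  | tail _ h ih => exact ih.trans h.2.le

lemma bruhatLE.eq_of_len_le {u v : W r} (h : bruhatLE u v) (hl : len v ≤ len u) : u = v := by
  rcases Relation.ReflTransGen.cases_tail h with h | ⟨w, h1, h2⟩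
  · exact h.symm
  · have := bruhatLE.len_le h1
    have := h2.2
    omega

lemma bruhatLE.len_lt {u v : W r} (h : bruhatLE u v) (hne : u ≠ v) : len u < len v :=
  lt_of_not_ge fun hl => hne (h.eq_of_len_le hl)

lemma bruhatLE.inv {u v : W r} (h : bruhatLE u v) : bruhatLE u⁻¹ v⁻¹ := by
  induction h with
  | refl => exact bruhatLE_refl _
  | @tail b c _ h ih =>
    obtain ⟨⟨t, ht, rfl⟩, hl⟩ := h
    refine ih.trans ?_
    have e : (b * t)⁻¹ = b⁻¹ * (b * t * b⁻¹) := by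
      obtain ⟨a, c, _, h⟩ := exists_isRefl_of_mem_reflections ht
      rw [mul_inv_rev, h.inv_eq]; group
    rw [e]
    exact bruhatLE_mul_reflection (conj_mem_reflections ht b) (by rwa [← e, len_inv, len_inv])

/-- The lifting property of the Bruhat order. -/
lemma bruhatLE.simple_mul {y v s : W r} (hs : s ∈ simpleRefl r) (h : bruhatLE y v)
    (hv : len v < len (s * v)) : bruhatLE (s * y) (s * v) := by
  have key : bruhatLE (s * y) v ∨ bruhatLE (s * y) (s * v) := by
    clear hv
    induction h with
    | refl => exact Or.inr (bruhatLE_refl _)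
    | @tail b c h1 h ih =>
      obtain ⟨⟨t, ht, rfl⟩, hl⟩ := h
      rcases ih with ih | ih
      · exact Or.inl (ih.trans (bruhatLE_mul_reflection ht hl))
      · obtain ⟨p, p', hp, h⟩ := exists_isRefl_of_mem_reflections ht
        by_cases hsb : len (s * b) < len (s * b * t)
        · rw [← mul_assoc]
          exact Or.inr (ih.trans (bruhatLE_mul_reflection ht hsb))
        -- Here `s` destroys the ascent from `b` to `b t`, so it interchanges `b p` and `b p'`. Thus
        -- `b t = s b`, and the bound known for `s b` is the one wanted.
        · left
          rw [len_lt_mul_refl_iff h hp] at hsb hl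
          obtain ⟨i, hi⟩ := mem_simpleRefl_iff.1 hs
          have hne : (s * b).1 p ≠ (s * b).1 p' := by simp [hp.ne]
          obtain ⟨h2, h3⟩ := hi.flip hl (lt_of_le_of_ne (not_lt.1 hsb) hne.symm)
          rw [h.mul_eq_mul (x := b) (t' := s) (h3 ▸ hi.isRefl h2)]
          exact ih
  rcases key with h | h
  · exact h.trans (bruhatLE_simple_mul hs hv)
  · exact h

/-- Elements of bounded displacement form a finite set. -/
lemma finite_bounded (M : ℤ) : {w : W r | ∀ i, |w.1 i - i| ≤ M}.Finite := by
  have hr : (0 : ℤ) < r := by exact_mod_cast Nat.pos_of_ne_zero (NeZero.ne r)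
  let F : W r → (Fin r → ℤ) := fun w i => w.1 i
  refine Set.Finite.of_finite_image (f := F) ?_ ?_
  · refine (Set.Finite.pi' (t := fun i : Fin r => Set.Icc ((i : ℤ) - M) (i + M))
      fun i => Set.finite_Icc _ _).subset ?_
    rintro _ ⟨w, hw, rfl⟩ i
    have := abs_le.1 (hw i)
    simp only [F, Set.mem_Icc]
    omega
  · intro w _ w' _ h
    refine W_ext fun j => ?_
    have h1 : (j % r).toNat < r := by
      have := Int.emod_lt_of_pos j hr
      omega
    have h2 := congrFun h ⟨(j % r).toNat, h1⟩
    have h3 : (((j % r).toNat : ℕ) : ℤ) = j % r := Int.toNat_of_nonneg (Int.emod_nonneg _ hr.ne')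
    simp only [F, h3] at h2
    have h4 : j ≡ j % r [ZMOD r] := (Int.mod_modEq _ _).symm
    rw [val_of_modEq w h4, val_of_modEq w' h4, h2]

lemma exists_displacement_bound (w : W r) : ∃ M : ℤ, ∀ i, |w.1 i - i| ≤ M := by
  have hr : (0 : ℤ) < r := by exact_mod_cast Nat.pos_of_ne_zero (NeZero.ne r)
  refine ⟨∑ j ∈ Finset.Ico (0 : ℤ) r, |w.1 j - j|, fun i => ?_⟩
  have h4 : i ≡ i % r [ZMOD r] := (Int.mod_modEq _ _).symm
  rw [show w.1 i - i = w.1 (i % r) - i % r by rw [val_of_modEq w h4]; ring]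
  exact Finset.single_le_sum (f := fun j : ℤ => |w.1 j - j|) (fun _ _ => abs_nonneg _)
    (Finset.mem_Ico.2 ⟨Int.emod_nonneg _ hr.ne', Int.emod_lt_of_pos _ hr⟩)

/-- If `p < p'` and `b p < b p'`, then `b p - p` and `b p' - p'` both lie between `b p - p'` and `b
p' - p`, which are displacements of `b t`. Hence lower Bruhat intervals are finite and the `finsum`
in `IsKL` is a genuine finite sum. -/
lemma bruhatLE.displacement_le {y w : W r} (h : bruhatLE y w) {M : ℤ}
    (hM : ∀ i, |w.1 i - i| ≤ M) (i : ℤ) : |y.1 i - i| ≤ M := by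
  induction h using Relation.ReflTransGen.head_induction_on generalizing i with
  | refl => exact hM i
  | @head b c h _ ih =>
    obtain ⟨⟨t, ht, rfl⟩, hl⟩ := h
    obtain ⟨p, p', hp, h⟩ := exists_isRefl_of_mem_reflections ht
    rw [len_lt_mul_refl_iff h hp] at hl
    by_cases h1 : i ≡ p [ZMOD r]
    · have e1 := abs_le.1 (ih p)
      have e2 := abs_le.1 (ih p')
      rw [mul_val_apply, h.apply_left] at e1
      rw [mul_val_apply, h.apply_right] at e2
      rw [val_of_modEq b h1, abs_le]
      constructor <;> linarith
    by_cases h2 : i ≡ p' [ZMOD r]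
    · have e1 := abs_le.1 (ih p)
      have e2 := abs_le.1 (ih p')
      rw [mul_val_apply, h.apply_left] at e1
      rw [mul_val_apply, h.apply_right] at e2
      rw [val_of_modEq b h2, abs_le]
      constructor <;> linarith
    have := ih i
    rwa [mul_val_apply, (h i).2.2 h1 h2] at this

lemma finite_bruhatLE (w : W r) : {y | bruhatLE y w}.Finite := by
  obtain ⟨M, hM⟩ := exists_displacement_bound w
  exact (finite_bounded M).subset fun y hy => bruhatLE.displacement_le hy hM

end Bruhat

/-! ### Parabolic subgroups and their double cosets -/

/-- A set of integers that is a union of residue classes mod `r` and contains `0`. -/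
structure IsCutSet (r : ℕ) (K : Set ℤ) : Prop where
  zero_mem : 0 ∈ K
  modEq : ∀ {i j : ℤ}, i ≡ j [ZMOD r] → i ∈ K → j ∈ K

/-- The affine permutations that preserve the half-lines `(-∞, i]` for `i ∈ K`. -/
def parabolic (r : ℕ) (K : Set ℤ) : Subgroup (W r) where
  carrier := {w | ∀ i ∈ K, ∀ a, w.1 a ≤ i ↔ a ≤ i}
  mul_mem' := by
    intro u v hu hv i hi a
    rw [mul_val_apply, hu i hi, hv i hi]
  one_mem' := fun i _ a => Iff.rfl
  inv_mem' := by
    intro u hu i hi a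
    rw [← hu i hi, val_inv_apply]

section Parabolic

variable {r : ℕ} [NeZero r] {K K' : Set ℤ}

lemma isRefl_mem_parabolic (hK : IsCutSet r K) {a b : ℤ} {t : W r} (ht : IsRefl a b t)
    (h : ∀ i ∈ K, a ≤ i ↔ b ≤ i) : t ∈ parabolic r K := by
  intro i hi j
  have key : ∀ c, j ≡ c [ZMOD r] → i - (j - c) ∈ K := fun c hc => hK.modEq (by
    have := (Int.ModEq.refl i).sub (hc.sub_right c)
    simpa using this.symm) hi
  by_cases h1 : j ≡ a [ZMOD r]
  · have := h _ (key _ h1)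
    rw [(ht j).1 h1]
    omega
  by_cases h2 : j ≡ b [ZMOD r]
  · have := h _ (key _ h2)
    rw [(ht j).2.1 h2]
    omega
  rw [(ht j).2.2 h1 h2]

/-- An inversion of `u` cannot straddle a cut `i`: from `a ≤ i < b` would follow `u a ≤ i < u b`. -/
lemma isRefl_mem_parabolic_of_flip (hK : IsCutSet r K) {a b : ℤ} {t u : W r} (ht : IsRefl a b t)
    (hu : u ∈ parabolic r K) (hab : a < b) (h : u.1 b < u.1 a) : t ∈ parabolic r K := by
  refine isRefl_mem_parabolic hK ht fun i hi => ?_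
  have h1 := hu i hi a
  have h2 := hu i hi b
  omega

lemma simple_mem_parabolic_iff (hK : IsCutSet r K) {i : ℤ} {s : W r} (hs : IsSimple r i s) :
    s ∈ parabolic r K ↔ i ∉ K := by
  refine ⟨fun h hi => ?_, fun hi => isRefl_mem_parabolic hK (hs.isRefl rfl) fun j hj => ?_⟩
  · have := h i hi i
    rw [(hs.isRefl rfl).apply_left] at this
    omega
  · have : i ≠ j := fun h => hi (h ▸ hj)
    omega

lemma parabolic_right_descent (hK : IsCutSet r K) {w : W r} (hw : w ∈ parabolic r K)
    (hne : w ≠ 1) : ∃ s ∈ simpleRefl r, s ∈ parabolic r K ∧ len (w * s) + 1 = len w := by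
  -- A shift by `k` preserves the half-line `(-∞, 0]` only for `k = 0`; this is why cut sets contain
  -- `0`.
  obtain ⟨i, s, hs, hi⟩ := exists_descent_of_ne (w := w) (fun k hk => by
    have h1 := hw 0 hK.zero_mem 0
    have h2 := hw 0 hK.zero_mem (-k)
    rw [hk, shift_zpow_apply] at h1 h2
    obtain rfl : k = 0 := by omega
    exact hne (by simpa using hk))
  have hs' := mem_simpleRefl_iff.2 ⟨i, hs⟩
  refine ⟨s, hs', isRefl_mem_parabolic_of_flip hK (hs.isRefl rfl) hw (lt_add_one i) hi, ?_⟩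
  have := len_mul_refl_lt (u := w) (hs.isRefl rfl) (lt_add_one i) hi
  rcases len_mul_simple hs' w with h | h <;> omega

lemma parabolic_induction_right (hK : IsCutSet r K) {P : W r → Prop} (one : P 1)
    (step : ∀ s ∈ simpleRefl r, s ∈ parabolic r K → ∀ w ∈ parabolic r K,
      len (w * s) = len w + 1 → P w → P (w * s)) : ∀ w ∈ parabolic r K, P w := by
  intro w hw
  induction hn : len w using Nat.strong_induction_on generalizing w with
  | _ n ih =>
    by_cases h1 : w = 1
    · exact h1 ▸ one
    obtain ⟨s, hs, hsK, h⟩ := parabolic_right_descent hK hw h1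
    have hws := (parabolic r K).mul_mem hw hsK
    have := step s hs hsK _ hws (by rw [mul_simple_cancel hs]; omega) (ih _ (by omega) _ hws rfl)
    rwa [mul_simple_cancel hs] at this

lemma parabolic_induction_left (hK : IsCutSet r K) {P : W r → Prop} (one : P 1)
    (step : ∀ s ∈ simpleRefl r, s ∈ parabolic r K → ∀ w ∈ parabolic r K,
      len (s * w) = len w + 1 → P w → P (s * w)) : ∀ w ∈ parabolic r K, P w := by
  intro w hw
  have := parabolic_induction_right hK (P := fun w => P w⁻¹) (by simpa using one)
    (fun s hs hsK w hw hl h => by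
      rw [mul_inv_rev, simple_inv hs]
      refine step s hs hsK _ (inv_mem hw) ?_ h
      rw [← len_inv, mul_inv_rev, inv_inv, simple_inv hs, hl, len_inv]) w⁻¹ (inv_mem hw)
  simpa using this

lemma closure_eq_parabolic (hK : IsCutSet r K) :
    Subgroup.closure {s : W r | s ∈ simpleRefl r ∧ s ∈ parabolic r K} = parabolic r K := by
  refine le_antisymm ((Subgroup.closure_le _).2 fun s hs => hs.2) fun w hw => ?_
  refine parabolic_induction_right hK (P := fun w => w ∈ Subgroup.closure
    {s : W r | s ∈ simpleRefl r ∧ s ∈ parabolic r K}) (one_mem _)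
    (fun s hs hsK w _ _ h => mul_mem h (Subgroup.subset_closure ⟨hs, hsK⟩)) w hw

/-- All multiples of `r` are cuts, and those around `i` confine `w i`, so displacements are bounded.
-/
lemma finite_parabolic (hK : IsCutSet r K) : (parabolic r K : Set (W r)).Finite := by
  have hr : (0 : ℤ) < r := by exact_mod_cast Nat.pos_of_ne_zero (NeZero.ne r)
  refine (finite_bounded (r := r) (2 * r)).subset fun w hw i => ?_
  have mem : ∀ k : ℤ, r * k ∈ K := fun k => hK.modEq (Int.modEq_iff_dvd.2 (by simp)) hK.zero_mem
  have h1 := hw _ (mem (i / r - 1)) i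
  have h2 := hw _ (mem (i / r + 1)) i
  have h3 := Int.mul_ediv_add_emod i r
  have h4 := Int.emod_nonneg i hr.ne'
  have h5 := Int.emod_lt_of_pos i hr
  rw [mul_sub, mul_one] at h1
  rw [mul_add, mul_one] at h2
  rw [abs_le]
  omega

/-- With every integer a cut the subgroup is trivial, so statements on double cosets also cover
one-sided cosets. -/
lemma parabolic_univ : parabolic r Set.univ = ⊥ := by
  refine (Subgroup.eq_bot_iff_forall _).2 fun w hw => W_ext fun j => ?_
  have h1 := hw j trivial j
  have h2 := hw (w.1 j) trivial j
  rw [one_val_apply]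
  omega

lemma isCutSet_univ : IsCutSet r Set.univ := ⟨trivial, fun _ _ => trivial⟩

lemma bruhatLE.mem_parabolic (hK : IsCutSet r K) {y w : W r} (h : bruhatLE y w)
    (hw : w ∈ parabolic r K) : y ∈ parabolic r K := by
  induction h using Relation.ReflTransGen.head_induction_on with
  | refl => exact hw
  | @head b c h _ ih =>
    obtain ⟨⟨t, ht, rfl⟩, hl⟩ := h
    obtain ⟨p, p', hp, h⟩ := exists_isRefl_of_mem_reflections ht
    rw [len_lt_mul_refl_iff h hp] at hl
    have ht' : t ∈ parabolic r K := isRefl_mem_parabolic_of_flip hK h ih hp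
      (by rwa [mul_val_apply, mul_val_apply, h.apply_left, h.apply_right])
    simpa [mul_assoc, h.mul_self] using mul_mem ih ht'

/-- The double coset of `w` with respect to two parabolic subgroups. -/
def pdcoset (K K' : Set ℤ) (w : W r) : Set (W r) :=
  DoubleCoset.doubleCoset w (parabolic r K : Set (W r)) (parabolic r K' : Set (W r))

lemma mem_pdcoset {w y : W r} : y ∈ pdcoset K K' w ↔
    ∃ u ∈ parabolic r K, ∃ v ∈ parabolic r K', y = u * w * v := DoubleCoset.mem_doubleCoset

lemma self_mem_pdcoset (w : W r) : w ∈ pdcoset K K' w :=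
  mem_pdcoset.2 ⟨1, one_mem _, 1, one_mem _, by simp⟩

lemma mul_mem_pdcoset_left {w y u : W r} (hu : u ∈ parabolic r K) :
    u * y ∈ pdcoset K K' w ↔ y ∈ pdcoset K K' w := by
  constructor
  · rintro h
    obtain ⟨a, ha, b, hb, h⟩ := mem_pdcoset.1 h
    exact mem_pdcoset.2 ⟨u⁻¹ * a, mul_mem (inv_mem hu) ha, b, hb, by
      rw [← inv_mul_cancel_left u y, h]; group⟩
  · rintro h
    obtain ⟨a, ha, b, hb, rfl⟩ := mem_pdcoset.1 h
    exact mem_pdcoset.2 ⟨u * a, mul_mem hu ha, b, hb, by group⟩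

lemma mul_mem_pdcoset_right {w y v : W r} (hv : v ∈ parabolic r K') :
    y * v ∈ pdcoset K K' w ↔ y ∈ pdcoset K K' w := by
  constructor
  · rintro h
    obtain ⟨a, ha, b, hb, h⟩ := mem_pdcoset.1 h
    exact mem_pdcoset.2 ⟨a, ha, b * v⁻¹, mul_mem hb (inv_mem hv), by
      rw [← mul_inv_cancel_right y v, h]; group⟩
  · rintro h
    obtain ⟨a, ha, b, hb, rfl⟩ := mem_pdcoset.1 h
    exact mem_pdcoset.2 ⟨a, ha, b * v, mul_mem hb hv, by group⟩

lemma pdcoset_eq_of_mem {w y : W r} (h : y ∈ pdcoset K K' w) : pdcoset K K' y = pdcoset K K' w :=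
  DoubleCoset.doubleCoset_eq_of_mem h

lemma mem_pdcoset_comm {w y : W r} : y ∈ pdcoset K K' w ↔ w ∈ pdcoset K K' y :=
  ⟨fun h => pdcoset_eq_of_mem h ▸ self_mem_pdcoset w,
    fun h => pdcoset_eq_of_mem h ▸ self_mem_pdcoset y⟩

lemma finite_pdcoset (hK : IsCutSet r K) (hK' : IsCutSet r K') (w : W r) :
    (pdcoset K K' w).Finite := by
  refine ((finite_parabolic hK).image2 (fun u v => u * w * v) (finite_parabolic hK')).subset ?_
  intro y hy
  obtain ⟨u, hu, v, hv, rfl⟩ := mem_pdcoset.1 hy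
  exact ⟨u, hu, v, hv, rfl⟩

/-! ### Elements of extremal length in double cosets. -/

/-- `y = u x v` with `u`, `v` in the parabolic subgroups and lengths adding up (`ε = 1`) or
`l(y) = l(x) - l(u) - l(v)` (`ε = -1`). -/
def ReducedFrom (K K' : Set ℤ) (ε : ℤ) (x y : W r) : Prop :=
  ∃ u ∈ parabolic r K, ∃ v ∈ parabolic r K', y = u * x * v ∧
    ε * len y = ε * len x + len u + len v

/-- The sign `ε` treats shortest and longest elements together. For `ε = -1` this is subadditivity
applied to `x = u⁻¹ (u x v) v⁻¹`. -/
lemma eps_len_le {ε : ℤ} (hε : ε = 1 ∨ ε = -1) (u x v : W r) :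
    ε * len (u * x * v) ≤ ε * len x + len u + len v := by
  have h1 := len_mul_le (u * x) v
  have h2 := len_mul_le u x
  have h3 := len_mul_le (u⁻¹ * (u * x * v)) v⁻¹
  have h4 := len_mul_le u⁻¹ (u * x * v)
  rw [show u⁻¹ * (u * x * v) * v⁻¹ = x by group] at h3
  rw [len_inv] at h3 h4
  rcases hε with rfl | rfl <;> omega

/-- The reflection `t` reverses a pair `a < b`, which is followed through `v`, then `x`, then `u`.
If `v` or `u` inverts the pair that reaches it, the reflection is absorbed there and shortens that
factor; `eps_len_le` and the drop of `ε l` by one then force equality of lengths. Otherwise only `x`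
matters, and extremality of `x` is violated. -/
lemma ReducedFrom.mul_refl (hK : IsCutSet r K) (hK' : IsCutSet r K') {ε : ℤ}
    (hε : ε = 1 ∨ ε = -1) {x y t : W r} (hx : ∀ z ∈ pdcoset K K' x, ε * len x ≤ ε * len z)
    (h : ReducedFrom K K' ε x y) (ht : t ∈ reflections r) (hmem : y * t ∈ pdcoset K K' x)
    (hl : ε * len (y * t) = ε * len y - 1) : ReducedFrom K K' ε x (y * t) := by
  obtain ⟨u, hu, v, hv, rfl, huv⟩ := h
  obtain ⟨a, b, hab, hr⟩ := exists_isRefl_of_mem_reflections ht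
  have finish : ∀ u' ∈ parabolic r K, ∀ v' ∈ parabolic r K', u * x * v * t = u' * x * v' →
      len u' + len v' < len u + len v → ReducedFrom K K' ε x (u * x * v * t) := by
    intro u' hu' v' hv' h1 h2
    refine ⟨u', hu', v', hv', h1, ?_⟩
    have h3 := eps_len_le hε u' x v'
    rw [h1] at hl ⊢
    omega
  rcases lt_trichotomy (v.1 a) (v.1 b) with hvab | hvab | hvab
  · have hr1 := hr.conj v
    have hr2 := hr1.conj x
    have e1 : u * x * v * t = u * (x * (v * t * v⁻¹)) * v := by group
    have e2 : u * x * v * t = u * (x * (v * t * v⁻¹) * x⁻¹) * x * v := by group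
    have hxne : x.1 (v.1 a) ≠ x.1 (v.1 b) := by simp [hab.ne]
    have hune : u.1 (x.1 (v.1 a)) ≠ u.1 (x.1 (v.1 b)) := by simp [hab.ne]
    have hz : x * (v * t * v⁻¹) ∈ pdcoset K K' x := by
      rwa [e1, mul_mem_pdcoset_right hv, mul_mem_pdcoset_left hu] at hmem
    have hz := hx _ hz
    have l1 := len_lt_mul_refl_iff (u := x) hr1 hvab
    have l2 := len_mul_refl_lt_iff (u := x) hr1 hvab
    have l3 := len_lt_mul_refl_iff (u := u * x * v) hr hab
    have l4 := len_mul_refl_lt_iff (u := u * x * v) hr hab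
    simp only [mul_val_apply] at l3 l4
    -- If `u` keeps the order of the two images, then `y t` compares with `y` as `x (v t v⁻¹)` does
    -- with `x`. But `x (v t v⁻¹)` lies in the double coset, so it cannot have smaller `ε l` than
    -- `x`.
    by_cases hflip : (x.1 (v.1 a) < x.1 (v.1 b) ↔ u.1 (x.1 (v.1 a)) < u.1 (x.1 (v.1 b)))
    · exfalso
      rcases hε with rfl | rfl <;> omega
    · have h1 : x * (v * t * v⁻¹) * x⁻¹ ∈ parabolic r K ∧
          len (u * (x * (v * t * v⁻¹) * x⁻¹)) < len u := by
        rcases lt_or_gt_of_ne hxne with h | h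
        · have h' : u.1 (x.1 (v.1 b)) < u.1 (x.1 (v.1 a)) := by omega
          exact ⟨isRefl_mem_parabolic_of_flip hK hr2 hu h h', len_mul_refl_lt hr2 h h'⟩
        · have h' : u.1 (x.1 (v.1 a)) < u.1 (x.1 (v.1 b)) := by omega
          exact ⟨isRefl_mem_parabolic_of_flip hK hr2.symm hu h h',
            len_mul_refl_lt hr2.symm h h'⟩
      exact finish _ (mul_mem hu h1.1) v hv e2 (by omega)
  · simp [hab.ne] at hvab
  · exact finish u hu (v * t) (mul_mem hv (isRefl_mem_parabolic_of_flip hK' hr hv hab hvab))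
      (by group) (by have := len_mul_refl_lt (u := v) hr hab hvab; omega)

/-- Every element of a double coset is reached from an element of extremal length in such a way
that lengths add up (minimal length) or subtract (maximal length). -/
lemma reducedFrom_of_extremal (hK : IsCutSet r K) (hK' : IsCutSet r K') {ε : ℤ}
    (hε : ε = 1 ∨ ε = -1) {x : W r} (hx : ∀ z ∈ pdcoset K K' x, ε * len x ≤ ε * len z)
    {y : W r} (hy : y ∈ pdcoset K K' x) : ReducedFrom K K' ε x y := by
  obtain ⟨u, hu, v, hv, rfl⟩ := mem_pdcoset.1 hy
  have hr : ∀ v ∈ parabolic r K', ReducedFrom K K' ε x (x * v) := by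
    refine parabolic_induction_right hK' ⟨1, one_mem _, 1, one_mem _, by simp, by simp [len_one]⟩ ?_
    intro s hs hsK' w hw _ ih
    have hmem : x * w * s ∈ pdcoset K K' x :=
      (mul_mem_pdcoset_right hsK').2 ((mul_mem_pdcoset_right hw).2 (self_mem_pdcoset x))
    rw [← mul_assoc]
    by_cases hl : ε * len (x * w * s) = ε * len (x * w) - 1
    · exact ih.mul_refl hK hK' hε hx (simple_mem_reflections hs) hmem hl
    · have hl' : ε * len (x * w * s) = ε * len (x * w) + 1 := by
        have := len_mul_simple hs (x * w)
        rcases hε with rfl | rfl <;> omega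
      obtain ⟨u', hu', v', hv', h1, h2⟩ := ih
      refine ⟨u', hu', v' * s, mul_mem hv' hsK', by rw [h1]; group, ?_⟩
      have h3 := eps_len_le hε u' x (v' * s)
      have h4 := len_mul_simple hs v'
      rw [← mul_assoc, ← h1] at h3
      omega
  clear hy
  revert u hu
  refine parabolic_induction_left hK (by simpa using hr v hv) ?_
  intro s hs hsK w hw _ ih
  have hmem : s * (w * x * v) ∈ pdcoset K K' x := (mul_mem_pdcoset_left hsK).2
    ((mul_mem_pdcoset_right hv).2 ((mul_mem_pdcoset_left hw).2 (self_mem_pdcoset x)))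
  rw [show s * w * x * v = s * (w * x * v) by group]
  set y := w * x * v
  by_cases hl : ε * len (s * y) = ε * len y - 1
  -- Left multiplication by `s` is right multiplication by the reflection `y⁻¹ s y`, which is why
  -- `ReducedFrom.mul_refl` allows arbitrary reflections.
  · have e : s * y = y * (y⁻¹ * s * y⁻¹⁻¹) := by group
    rw [e] at hmem hl ⊢
    exact ih.mul_refl hK hK' hε hx (conj_mem_reflections (simple_mem_reflections hs) _) hmem hl
  · have hl' : ε * len (s * y) = ε * len y + 1 := by
      have := len_simple_mul hs y
      rcases hε with rfl | rfl <;> omega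
    obtain ⟨u', hu', v', hv', h1, h2⟩ := ih
    refine ⟨s * u', mul_mem hsK hu', v', hv', by rw [h1]; group, ?_⟩
    have h3 := eps_len_le hε (s * u') x v'
    have h4 := len_simple_mul hs u'
    rw [show s * u' * x * v' = s * (u' * x * v') by group, ← h1] at h3
    omega

lemma eq_one_of_len_eq_zero (hK : IsCutSet r K) {u : W r} (hu : u ∈ parabolic r K)
    (h : len u = 0) : u = 1 := by
  by_contra hne
  obtain ⟨s, _, _, h1⟩ := parabolic_right_descent hK hu hne
  omega

lemma eq_of_extremal (hK : IsCutSet r K) (hK' : IsCutSet r K') {ε : ℤ}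
    (hε : ε = 1 ∨ ε = -1) {x : W r} (hx : ∀ z ∈ pdcoset K K' x, ε * len x ≤ ε * len z)
    {y : W r} (hy : y ∈ pdcoset K K' x) (hl : len y = len x) : y = x := by
  obtain ⟨u, hu, v, hv, rfl, h⟩ := reducedFrom_of_extremal hK hK' hε hx hy
  rw [hl] at h
  rw [eq_one_of_len_eq_zero hK hu (by omega), eq_one_of_len_eq_zero hK' hv (by omega)]
  simp

lemma exists_extremal (hK : IsCutSet r K) (hK' : IsCutSet r K') (ε : ℤ) (w : W r) :
    ∃ x ∈ pdcoset K K' w, ∀ z ∈ pdcoset K K' w, ε * len x ≤ ε * len z :=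
  Set.exists_min_image _ (fun z => ε * (len z : ℤ)) (finite_pdcoset hK hK' w)
    ⟨w, self_mem_pdcoset w⟩

/-- If `x` has minimal length in `W_K x`, then `l(u x) = l(u) + l(x)` for `u ∈ W_K`. -/
lemma len_mul_of_min (hK : IsCutSet r K) {x : W r} (hx : ∀ u ∈ parabolic r K, len x ≤ len (u * x))
    {u : W r} (hu : u ∈ parabolic r K) : len (u * x) = len u + len x := by
  have hmem : u * x ∈ pdcoset K Set.univ x := mem_pdcoset.2 ⟨u, hu, 1, one_mem _, by simp⟩
  obtain ⟨u', hu', v', hv', h1, h2⟩ := reducedFrom_of_extremal hK isCutSet_univ (Or.inl rfl)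
    (fun z hz => by
      obtain ⟨u', hu', v', hv', rfl⟩ := mem_pdcoset.1 hz
      rw [parabolic_univ, Subgroup.mem_bot] at hv'
      subst hv'
      have := hx u' hu'
      rw [mul_one]
      omega) hmem
  rw [parabolic_univ, Subgroup.mem_bot] at hv'
  subst hv'
  rw [mul_one] at h1
  obtain rfl := mul_right_cancel h1
  rw [len_one] at h2
  omega

end Parabolic

/-! ### Young subgroups -/

section Young

variable {r : ℕ} [NeZero r] {n : ℕ}

/-- The cut set of the Young subgroup `W_λ`. -/
def cuts (l : Lam n r) : Set ℤ :=
  {j | ¬ ∃ i : ℤ, i ≡ j [ZMOD r] ∧ 1 ≤ i ∧ i < r ∧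
    ∀ k : ℤ, 1 ≤ k → k ≤ n → i ≠ ∑ j ∈ Finset.Icc (1 : ℤ) k, (l.1 j : ℤ)}

lemma isCutSet_cuts (l : Lam n r) : IsCutSet r (cuts l) where
  zero_mem := by
    rintro ⟨i, h1, h2, h3, -⟩
    have := Int.le_of_dvd (by omega) (Int.modEq_iff_dvd.1 h1.symm)
    omega
  modEq := by
    rintro i j hij hi ⟨c, h1, h2⟩
    exact hi ⟨c, h1.trans hij.symm, h2⟩

/-- Exchanges generators for inequalities: `s_i` preserves all half-lines of a cut set exactly when
`i` is not a cut. -/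
lemma young_eq_parabolic (l : Lam n r) : young l = parabolic r (cuts l) := by
  rw [← closure_eq_parabolic (isCutSet_cuts l), young]
  congr 1
  ext s
  constructor
  · rintro ⟨i, h1, h2, hs, h3⟩
    refine ⟨⟨i, by omega, h2, hs⟩, (simple_mem_parabolic_iff (isCutSet_cuts l) hs).2 ?_⟩
    exact fun h => h ⟨i, rfl, h1, h2, h3⟩
  · rintro ⟨⟨i, _, _, hs⟩, h⟩
    rw [simple_mem_parabolic_iff (isCutSet_cuts l) hs] at h
    obtain ⟨j, h1, h2, h3, h4⟩ := not_not.1 h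
    exact ⟨j, h2, h3, hs.of_modEq h1, h4⟩

lemma dcoset_eq (l m : Lam n r) (w : W r) : dcoset l m w = pdcoset (cuts l) (cuts m) w := by
  rw [dcoset, young_eq_parabolic, young_eq_parabolic, pdcoset]

lemma theUnique_spec {α : Type*} {d : α} {P : α → Prop} (h : ∃! a, P a) : P (theUnique d P) := by
  rw [theUnique, dif_pos h]
  exact h.choose_spec.1

lemma theUnique_eq {α : Type*} {d : α} {P : α → Prop} (h : ∃! a, P a) {a : α} (ha : P a) :
    theUnique d P = a := h.unique (theUnique_spec h) ha

lemma plus_spec (l m : Lam n r) (w : W r) : plus l m w ∈ dcoset l m w ∧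
    ∀ y ∈ dcoset l m w, len y ≤ len (plus l m w) := by
  have hl := isCutSet_cuts l
  have hm := isCutSet_cuts m
  refine theUnique_spec (P := fun x => x ∈ dcoset l m w ∧ ∀ y ∈ dcoset l m w, len y ≤ len x) ?_
  rw [dcoset_eq]
  obtain ⟨x, hx, hmax⟩ := exists_extremal hl hm (-1) w
  refine ⟨x, ⟨hx, fun y hy => by have := hmax y hy; omega⟩, fun y hy => ?_⟩
  rw [← pdcoset_eq_of_mem hx] at hmax hy
  have h1 := hmax y hy.1
  have h2 := hy.2 x (self_mem_pdcoset x)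
  exact eq_of_extremal hl hm (Or.inr rfl) hmax hy.1 (by omega)

lemma minReps_eq_of_mem {l m : Lam n r} {z z' : W r} (hz : z ∈ minReps l m)
    (hz' : z' ∈ minReps l m) (h : z' ∈ dcoset l m z) : z' = z := by
  have hz : ∀ y ∈ dcoset l m z, len z ≤ len y := hz
  have hz' : ∀ y ∈ dcoset l m z', len z' ≤ len y := hz'
  rw [dcoset_eq] at hz hz' h
  rw [pdcoset_eq_of_mem h] at hz'
  exact eq_of_extremal (isCutSet_cuts l) (isCutSet_cuts m) (Or.inl rfl)
    (fun y hy => by have := hz y hy; omega) h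
    (le_antisymm (hz' z (self_mem_pdcoset z)) (hz _ h))

lemma exists_minRep (l m : Lam n r) (w : W r) : ∃ z ∈ minReps l m, w ∈ dcoset l m z := by
  obtain ⟨x, hx, hmin⟩ := exists_extremal (isCutSet_cuts l) (isCutSet_cuts m) 1 w
  refine ⟨x, fun y hy => ?_, ?_⟩
  · rw [dcoset_eq, pdcoset_eq_of_mem hx] at hy
    have := hmin y hy
    omega
  · rw [dcoset_eq, mem_pdcoset_comm]
    exact hx

/-- `W_μ` is the double coset of `1` with the trivial group on the left, so the case `ε = -1` of
`reducedFrom_of_extremal` applies. The factorization gives a Bruhat chain from each element of `W_μ`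
up to `w_{0,μ}`. -/
lemma w0_spec (m : Lam n r) : w0 m ∈ parabolic r (cuts m) ∧
    ∀ y ∈ parabolic r (cuts m), ∃ v ∈ parabolic r (cuts m), w0 m = y * v ∧
      len (w0 m) = len y + len v := by
  have hm := isCutSet_cuts m
  have hco : ∀ y : W r, y ∈ pdcoset Set.univ (cuts m) 1 ↔ y ∈ parabolic r (cuts m) := fun y => by
    rw [← one_mul y]
    constructor
    · intro h
      obtain ⟨u, hu, v, hv, h⟩ := mem_pdcoset.1 h
      rw [parabolic_univ, Subgroup.mem_bot] at hu
      rw [h, hu]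
      simpa using hv
    · intro h
      exact mem_pdcoset.2 ⟨1, one_mem _, 1 * y, h, by simp⟩
  obtain ⟨x, hx, hmax⟩ := exists_extremal isCutSet_univ hm (-1) (1 : W r)
  have hmax' := hmax
  rw [← pdcoset_eq_of_mem hx] at hmax'
  have hw : w0 m = x := by
    refine theUnique_eq (a := x) ?_ ⟨by rwa [young_eq_parabolic, SetLike.mem_coe, ← hco], ?_⟩
    · refine ⟨x, ⟨by rwa [young_eq_parabolic, SetLike.mem_coe, ← hco], ?_⟩, ?_⟩
      · intro y hy
        rw [young_eq_parabolic, SetLike.mem_coe, ← hco] at hy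
        have := hmax y hy
        omega
      · rintro y ⟨hy, h⟩
        rw [young_eq_parabolic] at hy h
        rw [SetLike.mem_coe, ← hco] at hy
        have h1 := h x ((hco x).1 hx)
        have h2 := hmax y hy
        exact eq_of_extremal isCutSet_univ hm (Or.inr rfl) hmax'
          (by rwa [pdcoset_eq_of_mem hx]) (by omega)
    · intro y hy
      rw [young_eq_parabolic, SetLike.mem_coe, ← hco] at hy
      have := hmax y hy
      omega
  rw [hw]
  refine ⟨(hco x).1 hx, fun y hy => ?_⟩
  rw [← hco, ← pdcoset_eq_of_mem hx] at hy
  obtain ⟨u, hu, v, hv, h1, h2⟩ := reducedFrom_of_extremal isCutSet_univ hm (Or.inr rfl) hmax' hy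
  rw [parabolic_univ, Subgroup.mem_bot] at hu
  subst hu
  rw [len_one] at h2
  rw [one_mul] at h1
  exact ⟨v⁻¹, inv_mem hv, by rw [h1]; group, by rw [len_inv]; push_cast at h2; omega⟩

lemma bruhatLE_w0_iff (m : Lam n r) {y : W r} :
    bruhatLE y (w0 m) ↔ y ∈ parabolic r (cuts m) := by
  have hm := isCutSet_cuts m
  obtain ⟨h0, h1⟩ := w0_spec m
  refine ⟨fun h => h.mem_parabolic hm h0, fun hy => ?_⟩
  obtain ⟨v, hv, e, hl⟩ := h1 y hy
  rw [e] at hl ⊢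
  clear e h1 h0
  revert v
  have := parabolic_induction_right hm (P := fun v => len (y * v) = len y + len v →
    bruhatLE y (y * v)) (by simp [bruhatLE_refl]) (by
      intro s hs hsK w hw hl ih h
      rw [← mul_assoc] at h ⊢
      have h1 := len_mul_le y w
      have h2 := len_mul_simple hs (y * w)
      exact (ih (by omega)).trans
        (bruhatLE_mul_reflection (simple_mem_reflections hs) (by omega)))
  exact fun v hv hl => this v hv hl

end Young

/-! ### Powers of `t` -/

lemma tpow_add (m k : ℤ) : tpow (m + k) = tpow m * tpow k := LaurentPolynomial.T_add m k

lemma tpow_zero : tpow 0 = 1 := LaurentPolynomial.T_zero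

lemma invert_tpow (m : ℤ) : LaurentPolynomial.invert (tpow m) = tpow (-m) :=
  LaurentPolynomial.invert_T m

lemma q_mul_tpow : q * tpow (-2) = 1 := by rw [q, ← tpow_add]; exact tpow_zero

lemma tpow_mul_q : tpow (-2) * q = 1 := by rw [mul_comm, q_mul_tpow]

lemma coeff_tpow_mul (m k : ℤ) (f : 𝓐) : (tpow m * f).coeff k = f.coeff (k - m) := by
  have := AddMonoidAlgebra.coeff_single_mul_add f (1 : ℤ) m (k - m)
  rw [one_mul, add_sub_cancel] at this
  exact this

/-! ### The standard basis of the Hecke algebra -/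

section HeckeBasis

variable {r : ℕ}

namespace Hecke

/-- The universal property of the Hecke algebra. -/
def lift {A : Type*} [Ring A] [Algebra 𝓐 A] (f : W r → A) (h1 : f 1 = 1)
    (hmul : ∀ w w', len (w * w') = len w + len w' → f w * f w' = f (w * w'))
    (hquad : ∀ s ∈ simpleRefl r, (f s + 1) * (f s - algebraMap 𝓐 A q) = 0) :
    Hecke r →ₐ[𝓐] A :=
  RingQuot.liftAlgHom 𝓐 ⟨FreeAlgebra.lift 𝓐 f, by
    rintro _ _ (_ | ⟨w, w', h⟩ | ⟨s, hs⟩)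
    · simpa using h1
    · simpa using hmul w w' h
    · simpa using hquad s hs⟩

lemma lift_T {A : Type*} [Ring A] [Algebra 𝓐 A] (f : W r → A) (h1 : f 1 = 1)
    (hmul : ∀ w w', len (w * w') = len w + len w' → f w * f w' = f (w * w'))
    (hquad : ∀ s ∈ simpleRefl r, (f s + 1) * (f s - algebraMap 𝓐 A q) = 0) (w : W r) :
    lift f h1 hmul hquad (T w) = f w := by
  refine (RingQuot.liftAlgHom_mkAlgHom_apply 𝓐 _ _ _).trans ?_
  simp

/-- The quotient map from the free algebra. -/
def mk (r : ℕ) : FreeAlgebra 𝓐 (W r) →ₐ[𝓐] Hecke r := RingQuot.mkAlgHom 𝓐 (HeckeRel r)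

lemma mk_surjective : Function.Surjective (mk r) := RingQuot.mkAlgHom_surjective 𝓐 (HeckeRel r)

lemma mk_rel {x y : FreeAlgebra 𝓐 (W r)} (h : HeckeRel r x y) : mk r x = mk r y :=
  RingQuot.mkAlgHom_rel 𝓐 h

lemma mk_ι (w : W r) : mk r (FreeAlgebra.ι 𝓐 w) = T w := rfl

end Hecke

open Hecke (mk mk_rel mk_ι mk_surjective)

lemma T_one : T (1 : W r) = 1 := by rw [← mk_ι, mk_rel HeckeRel.one, map_one]

lemma T_mul {w w' : W r} (h : len (w * w') = len w + len w') : T w * T w' = T (w * w') := by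
  rw [← mk_ι, ← mk_ι, ← mk_ι, ← mk_rel (HeckeRel.mul w w' h), map_mul]

lemma T_quad {s : W r} (hs : s ∈ simpleRefl r) :
    (T s + 1) * (T s - algebraMap 𝓐 (Hecke r) q) = 0 := by
  have := mk_rel (HeckeRel.quad s hs)
  simpa only [map_mul, map_add, map_sub, map_one, map_zero, AlgHom.commutes, mk_ι] using this

lemma T_sq {s : W r} (hs : s ∈ simpleRefl r) :
    T s * T s = (q - 1) • T s + q • (1 : Hecke r) := by
  have := T_quad hs
  rw [Algebra.algebraMap_eq_smul_one, mul_sub, mul_smul_comm, mul_one, add_mul, one_mul,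
    sub_eq_zero] at this
  rw [eq_sub_of_add_eq this]
  module

variable [NeZero r]

lemma T_shift_mul (k : ℤ) (w : W r) : T (shift r ^ k) * T w = T (shift r ^ k * w) :=
  T_mul (by rw [len_shift_mul, len_shift_zpow, zero_add])

lemma T_simple_mul_of_lt {s w : W r} (hs : s ∈ simpleRefl r) (h : len w < len (s * w)) :
    T s * T w = T (s * w) := T_mul (by
  have := len_simple_mul hs w
  rw [len_simple hs]; omega)

lemma T_simple_mul_of_not_lt {s w : W r} (hs : s ∈ simpleRefl r) (h : ¬ len w < len (s * w)) :
    T s * T w = q • T (s * w) + (q - 1) • T w := by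
  have h1 : T w = T s * T (s * w) := by
    rw [T_simple_mul_of_lt hs, simple_mul_cancel hs]
    have := len_simple_mul hs w
    rw [simple_mul_cancel hs]; omega
  conv_lhs => rw [h1, ← mul_assoc, T_sq hs, add_mul, smul_mul_assoc, ← h1, smul_one_mul]
  rw [add_comm]

/-- By induction on the length the span is stable under left multiplication by every `T_w`; hence it
is a left ideal, and it contains `1`. -/
lemma span_T : Submodule.span 𝓐 (Set.range (T (r := r))) = ⊤ := by
  set N := Submodule.span 𝓐 (Set.range (T (r := r))) with hN
  have hT : ∀ w, T (r := r) w ∈ N := fun w => Submodule.subset_span ⟨w, rfl⟩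
  have extend : ∀ x : Hecke r, (∀ w, x * T w ∈ N) → ∀ h ∈ N, x * h ∈ N := fun x hx h hh => by
    have : N ≤ N.comap (LinearMap.mulLeft 𝓐 x) := by
      rw [hN, Submodule.span_le]
      rintro _ ⟨w, rfl⟩
      exact hx w
    exact this hh
  have hmul : ∀ w : W r, ∀ h ∈ N, T w * h ∈ N := by
    refine len_induction_left (fun k => extend _ fun w => ?_) fun s hs w hl ih h hh => ?_
    · rw [T_shift_mul]; exact hT _
    · rw [← T_simple_mul_of_lt hs (by omega), mul_assoc]
      refine extend _ (fun v => ?_) _ (ih h hh)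
      by_cases hv : len v < len (s * v)
      · rw [T_simple_mul_of_lt hs hv]; exact hT _
      · rw [T_simple_mul_of_not_lt hs hv]
        exact add_mem (N.smul_mem _ (hT _)) (N.smul_mem _ (hT _))
  have h1 : (1 : Hecke r) ∈ N := T_one (r := r) ▸ hT 1
  rw [eq_top_iff]
  rintro x -
  obtain ⟨y, rfl⟩ := mk_surjective x
  have key : ∀ h ∈ N, mk r y * h ∈ N := by
    induction y using FreeAlgebra.induction with
    | grade0 a =>
      intro h hh
      rw [AlgHom.commutes, Algebra.algebraMap_eq_smul_one, smul_one_mul]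
      exact N.smul_mem _ hh
    | grade1 w => exact hmul w
    | mul a b ha hb =>
      intro h hh
      rw [map_mul, mul_assoc]
      exact ha _ (hb _ hh)
    | add a b ha hb =>
      intro h hh
      rw [map_add, add_mul]
      exact add_mem (ha _ hh) (hb _ hh)
  simpa using key 1 h1

/-! ### The regular representation and linear independence of the `T_w`. -/

open Classical in
/-- The operator on the free module on `W` that models left multiplication by `T_s`. -/
def leftOp (s : W r) : Module.End 𝓐 (W r →₀ 𝓐) :=
  Finsupp.linearCombination 𝓐 fun w =>
    if len w < len (s * w) then Finsupp.single (s * w) 1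
    else q • Finsupp.single (s * w) 1 + (q - 1) • Finsupp.single w 1

open Classical in
/-- The operator on the free module on `W` that models right multiplication by `T_s`. -/
def rightOp (s : W r) : Module.End 𝓐 (W r →₀ 𝓐) :=
  Finsupp.linearCombination 𝓐 fun w =>
    if len w < len (w * s) then Finsupp.single (w * s) 1
    else q • Finsupp.single (w * s) 1 + (q - 1) • Finsupp.single w 1

/-- Translation by `ρ^k` from the left. -/
def leftShift (k : ℤ) : Module.End 𝓐 (W r →₀ 𝓐) := Finsupp.lmapDomain 𝓐 𝓐 (shift r ^ k * ·)

/-- Translation by `ρ^k` from the right. -/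
def rightShift (k : ℤ) : Module.End 𝓐 (W r →₀ 𝓐) := Finsupp.lmapDomain 𝓐 𝓐 (· * shift r ^ k)

open Classical in
lemma leftOp_single (s w : W r) : leftOp s (Finsupp.single w 1) =
    if len w < len (s * w) then Finsupp.single (s * w) 1
    else q • Finsupp.single (s * w) 1 + (q - 1) • Finsupp.single w 1 := by
  rw [leftOp, Finsupp.linearCombination_single, one_smul]

open Classical in
lemma rightOp_single (s w : W r) : rightOp s (Finsupp.single w 1) =
    if len w < len (w * s) then Finsupp.single (w * s) 1
    else q • Finsupp.single (w * s) 1 + (q - 1) • Finsupp.single w 1 := by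
  rw [rightOp, Finsupp.linearCombination_single, one_smul]

lemma leftShift_single (k : ℤ) (w : W r) :
    leftShift k (Finsupp.single w 1) = Finsupp.single (shift r ^ k * w) 1 := by
  simp [leftShift]

lemma rightShift_single (k : ℤ) (w : W r) :
    rightShift k (Finsupp.single w 1) = Finsupp.single (w * shift r ^ k) 1 := by
  simp [rightShift]

lemma end_ext {f g : Module.End 𝓐 (W r →₀ 𝓐)}
    (h : ∀ w, f (Finsupp.single w 1) = g (Finsupp.single w 1)) : f = g :=
  Finsupp.lhom_ext' fun w => LinearMap.ext_ring (h w)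

/-- Unless `s w = w s'`, left and right ascents are independent of each other and the two composites
agree term by term. In the exceptional case `s` and `s'` act on the same pair `w, s w` by the same
formula. -/
lemma leftOp_mul_rightOp {s s' : W r} (hs : s ∈ simpleRefl r) (hs' : s' ∈ simpleRefl r) :
    leftOp s * rightOp s' = rightOp s' * leftOp s := by
  refine end_ext fun w => ?_
  rw [Module.End.mul_apply, Module.End.mul_apply, leftOp_single, rightOp_single]
  by_cases h : s * w = w * s'
  · have hx1 := simple_mul_cancel hs w
    have hx2 : s * w * s' = w := by rw [h, mul_simple_cancel hs']
    have hl := len_simple_mul hs w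
    by_cases h1 : len w < len (s * w)
    · have h3 : ¬ len (s * w) < len w := by omega
      simp only [leftOp_single, rightOp_single, ← h, hx1, hx2, h1, h3, if_true, if_false]
    · have h3 : len (s * w) < len w := by omega
      simp only [leftOp_single, rightOp_single, ← h, hx1, hx2, h1, h3, if_true, if_false, map_add,
        map_smul]
  · have e1 := left_ascent_mul_right hs hs' h
    have e2 := right_ascent_mul_left hs hs' h
    rw [mul_assoc] at e2
    by_cases h1 : len w < len (s * w) <;> by_cases h2 : len w < len (w * s') <;>
      simp only [h1, h2, map_add, map_smul, leftOp_single, rightOp_single, ← e1, ← e2, mul_assoc,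
        if_true, if_false]
    module

/-- The operators that commute with all right multiplications. -/
def CommutesRight (f : Module.End 𝓐 (W r →₀ 𝓐)) : Prop :=
  (∀ s ∈ simpleRefl r, f * rightOp s = rightOp s * f) ∧
    ∀ k, f * rightShift k = rightShift k * f

lemma CommutesRight.mul {f g : Module.End 𝓐 (W r →₀ 𝓐)} (hf : CommutesRight f)
    (hg : CommutesRight g) : CommutesRight (f * g) :=
  ⟨fun s hs => by rw [mul_assoc, hg.1 s hs, ← mul_assoc, hf.1 s hs, mul_assoc],
    fun k => by rw [mul_assoc, hg.2 k, ← mul_assoc, hf.2 k, mul_assoc]⟩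

lemma CommutesRight.add {f g : Module.End 𝓐 (W r →₀ 𝓐)} (hf : CommutesRight f)
    (hg : CommutesRight g) : CommutesRight (f + g) :=
  ⟨fun s hs => by rw [add_mul, mul_add, hf.1 s hs, hg.1 s hs],
    fun k => by rw [add_mul, mul_add, hf.2 k, hg.2 k]⟩

lemma commutesRight_algebraMap (a : 𝓐) :
    CommutesRight (algebraMap 𝓐 (Module.End 𝓐 (W r →₀ 𝓐)) a) :=
  ⟨fun _ _ => Algebra.commutes _ _, fun _ => Algebra.commutes _ _⟩

lemma commutesRight_leftOp {s : W r} (hs : s ∈ simpleRefl r) : CommutesRight (leftOp s) := by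
  refine ⟨fun s' hs' => leftOp_mul_rightOp hs hs', fun k => end_ext fun w => ?_⟩
  rw [Module.End.mul_apply, Module.End.mul_apply, rightShift_single, leftOp_single, leftOp_single,
    ← mul_assoc, len_mul_shift, len_mul_shift]
  split_ifs <;> simp only [map_add, map_smul, rightShift_single]

lemma commutesRight_leftShift (k : ℤ) : CommutesRight (leftShift (r := r) k) := by
  refine ⟨fun s hs => end_ext fun w => ?_, fun m => end_ext fun w => ?_⟩
  · rw [Module.End.mul_apply, Module.End.mul_apply, leftShift_single, rightOp_single,
      rightOp_single, mul_assoc, len_shift_mul, len_shift_mul]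
    split_ifs <;> simp only [map_add, map_smul, leftShift_single]
  · simp only [Module.End.mul_apply, leftShift_single, rightShift_single, mul_assoc]

/-- Right operators produce every basis vector from that of `1`. Identities between operators
commuting with them therefore need checking on one vector only, and no braid relations are required.
-/
lemma CommutesRight.ext {f g : Module.End 𝓐 (W r →₀ 𝓐)} (hf : CommutesRight f)
    (hg : CommutesRight g) (h : f (Finsupp.single 1 1) = g (Finsupp.single 1 1)) : f = g := by
  refine end_ext fun w => ?_
  induction w using len_induction_right with
  | base k =>
    have e : Finsupp.single (shift r ^ k) (1 : 𝓐) = rightShift k (Finsupp.single 1 1) := by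
      rw [rightShift_single, one_mul]
    rw [e, ← Module.End.mul_apply, ← Module.End.mul_apply, hf.2, hg.2, Module.End.mul_apply,
      Module.End.mul_apply, h]
  | step s hs w hl ih =>
    have e : Finsupp.single (w * s) (1 : 𝓐) = rightOp s (Finsupp.single w 1) := by
      rw [rightOp_single, if_pos (by omega)]
    rw [e, ← Module.End.mul_apply, ← Module.End.mul_apply, hf.1 s hs, hg.1 s hs,
      Module.End.mul_apply, Module.End.mul_apply, ih]

/-- The operator is a product of left operators along a reduced word of `w`; independence of the
word is a consequence of `CommutesRight.ext`. -/
lemma exists_commutesRight (w : W r) : ∃ f : Module.End 𝓐 (W r →₀ 𝓐), CommutesRight f ∧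
    ∀ v, len (w * v) = len w + len v → f (Finsupp.single v 1) = Finsupp.single (w * v) 1 := by
  induction w using len_induction_left with
  | base k => exact ⟨leftShift k, commutesRight_leftShift k, fun v _ => leftShift_single k v⟩
  | step s hs w hl ih =>
    obtain ⟨f, hf, hv⟩ := ih
    refine ⟨leftOp s * f, (commutesRight_leftOp hs).mul hf, fun v h => ?_⟩
    rw [mul_assoc] at h ⊢
    have h1 := len_mul_le w v
    have h2 := len_simple_mul hs (w * v)
    rw [Module.End.mul_apply, hv v (by omega), leftOp_single, if_pos (by omega)]

/-- The operator on the free module on `W` that models left multiplication by `T_w`. -/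
def regOp (w : W r) : Module.End 𝓐 (W r →₀ 𝓐) := (exists_commutesRight w).choose

lemma commutesRight_regOp (w : W r) : CommutesRight (regOp w) :=
  (exists_commutesRight w).choose_spec.1

lemma regOp_single {w v : W r} (h : len (w * v) = len w + len v) :
    regOp w (Finsupp.single v 1) = Finsupp.single (w * v) 1 :=
  (exists_commutesRight w).choose_spec.2 v h

lemma regOp_single_one (w : W r) : regOp w (Finsupp.single 1 1) = Finsupp.single w 1 := by
  rw [regOp_single (by simp [len_one]), mul_one]

lemma regOp_simple {s : W r} (hs : s ∈ simpleRefl r) : regOp s = leftOp s := by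
  refine (commutesRight_regOp s).ext (commutesRight_leftOp hs) ?_
  rw [regOp_single_one, leftOp_single, mul_one, if_pos (by rw [len_one, len_simple hs]; omega)]

/-- The regular representation of the Hecke algebra. -/
def regRep (r : ℕ) [NeZero r] : Hecke r →ₐ[𝓐] Module.End 𝓐 (W r →₀ 𝓐) :=
  Hecke.lift regOp
    ((commutesRight_regOp 1).ext (by simpa using commutesRight_algebraMap (r := r) 1) (by
      rw [regOp_single_one, Module.End.one_apply]))
    (fun w w' h => ((commutesRight_regOp w).mul (commutesRight_regOp w')).ext
      (commutesRight_regOp _) (by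
        rw [Module.End.mul_apply, regOp_single_one, regOp_single h, regOp_single_one]))
    (fun s hs => by
      rw [regOp_simple hs]
      have h1 := (commutesRight_leftOp hs).add (commutesRight_algebraMap 1)
      have h2 := (commutesRight_leftOp hs).add (commutesRight_algebraMap (-q))
      rw [map_one] at h1
      rw [map_neg, ← sub_eq_add_neg] at h2
      have h0 : CommutesRight (0 : Module.End 𝓐 (W r →₀ 𝓐)) := by
        simpa using commutesRight_algebraMap (r := r) 0
      refine (h1.mul h2).ext h0 ?_
      have e1 : leftOp s (Finsupp.single 1 1) = Finsupp.single s 1 := by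
        rw [leftOp_single, mul_one, if_pos (by rw [len_one, len_simple hs]; omega)]
      have e2 : leftOp s (Finsupp.single s 1) =
          q • Finsupp.single 1 1 + (q - 1) • Finsupp.single s 1 := by
        rw [leftOp_single, simple_mul_self hs,
          if_neg (by rw [len_one, len_simple hs]; omega)]
      simp only [Module.End.mul_apply, LinearMap.add_apply, LinearMap.sub_apply,
        Module.algebraMap_end_apply, map_sub, map_smul, e1, e2, Module.End.one_apply,
        LinearMap.zero_apply]
      module)

lemma regRep_T (w : W r) : regRep r (T w) (Finsupp.single 1 1) = Finsupp.single w 1 := by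
  rw [regRep, Hecke.lift_T, regOp_single_one]

/-- The basis `{T_w}` of the Hecke algebra. -/
def TBasis (r : ℕ) [NeZero r] : Module.Basis (W r) 𝓐 (Hecke r) :=
  Module.Basis.mk (v := T) (by
    let e : Hecke r →ₗ[𝓐] (W r →₀ 𝓐) :=
      (LinearMap.applyₗ (Finsupp.single 1 1)).comp (regRep r).toLinearMap
    refine LinearIndependent.of_comp e ?_
    have : e ∘ T = fun w => Finsupp.single w 1 := funext regRep_T
    rw [this]
    exact Finsupp.linearIndependent_single_one 𝓐 (W r)) span_T.ge

lemma TBasis_apply (w : W r) : TBasis r w = T w := by simp [TBasis]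

end HeckeBasis

/-! ### Coefficients with respect to the standard basis. -/

section Coefficients

variable {r : ℕ} [NeZero r]

/-- The coefficient of `T_w` in an element of the Hecke algebra. -/
def coef (w : W r) : Hecke r →ₗ[𝓐] 𝓐 := (TBasis r).coord w

open Classical in
lemma coef_T (w v : W r) : coef w (T v) = if v = w then 1 else 0 := by
  rw [← TBasis_apply, coef, Module.Basis.coord_apply, Module.Basis.repr_self,
    Finsupp.single_apply]

lemma hecke_ext {h h' : Hecke r} (H : ∀ w, coef w h = coef w h') : h = h' :=
  (TBasis r).ext_elem H

lemma hecke_linear_ext {M : Type*} [AddCommMonoid M] [Module 𝓐 M] {f g : Hecke r →ₗ[𝓐] M}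
    (H : ∀ w, f (T w) = g (T w)) : f = g :=
  (TBasis r).ext fun w => by simpa only [TBasis_apply] using H w

/-- The finite set of those `w` for which the coefficient of `T_w` is not zero. -/
def supp (h : Hecke r) : Finset (W r) := ((TBasis r).repr h).support

lemma mem_supp {h : Hecke r} {w : W r} : w ∈ supp h ↔ coef w h ≠ 0 := Finsupp.mem_support_iff

lemma eq_sum_supp (h : Hecke r) : h = ∑ w ∈ supp h, coef w h • T w := by
  conv_lhs => rw [← (TBasis r).linearCombination_repr h, Finsupp.linearCombination_apply,
    Finsupp.sum]
  exact Finset.sum_congr rfl fun w _ => by rw [TBasis_apply]; rfl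

lemma coef_simple_mul {s : W r} (hs : s ∈ simpleRefl r) (w : W r) (h : Hecke r) :
    coef w (T s * h) = if len w < len (s * w) then q * coef (s * w) h
      else coef (s * w) h + (q - 1) * coef w h := by
  classical
  have key : ∀ v, coef w (T s * T v) = if len w < len (s * w) then q * coef (s * w) (T v)
      else coef (s * w) (T v) + (q - 1) * coef w (T v) := by
    intro v
    have e : s * v = w ↔ v = s * w := by
      constructor
      · rintro rfl; rw [simple_mul_cancel hs]
      · rintro rfl; rw [simple_mul_cancel hs]
    by_cases hv : len v < len (s * v)
    · rw [T_simple_mul_of_lt hs hv]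
      simp only [coef_T, e]
      by_cases h1 : v = s * w
      · have h2 : ¬ len w < len (s * w) := by
          rw [h1, simple_mul_cancel hs] at hv; omega
        have h3 : v ≠ w := by rintro rfl; rw [← h1] at hv; omega
        simp [h1, h2, h1 ▸ h3]
      · by_cases h3 : v = w
        · subst h3; simp [hv, h1]
        · simp [h1, h3]
    · rw [T_simple_mul_of_not_lt hs hv]
      simp only [map_add, map_smul, coef_T, e, smul_eq_mul]
      by_cases h1 : v = s * w
      · have h2 : len w < len (s * w) := by
          have := len_simple_mul hs w
          rw [h1, simple_mul_cancel hs] at hv; omega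
        have h3 : v ≠ w := by rintro rfl; rw [← h1] at h2; omega
        simp [h1, h2, h1 ▸ h3]
      · by_cases h3 : v = w
        · subst h3; simp [hv, h1]
        · simp [h1, h3]
  by_cases hw : len w < len (s * w)
  · simp only [hw, if_true] at key ⊢
    have : (coef w).comp (LinearMap.mulLeft 𝓐 (T s)) = q • coef (s * w) :=
      hecke_linear_ext key
    exact LinearMap.congr_fun this h
  · simp only [hw, if_false] at key ⊢
    have : (coef w).comp (LinearMap.mulLeft 𝓐 (T s)) = coef (s * w) + (q - 1) • coef w :=
      hecke_linear_ext key
    exact LinearMap.congr_fun this h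

end Coefficients

/-! ### The anti-involution `T_w ↦ T_{w⁻¹}` -/

section AntiInvolution

variable {r : ℕ} [NeZero r]

/-- The anti-involution `T_w ↦ T_{w⁻¹}`, as a homomorphism to the opposite algebra. -/
def antiInvHom (r : ℕ) [NeZero r] : Hecke r →ₐ[𝓐] (Hecke r)ᵐᵒᵖ :=
  Hecke.lift (fun w => MulOpposite.op (T w⁻¹))
    (by rw [inv_one, T_one, MulOpposite.op_one])
    (fun w w' h => by
      rw [← MulOpposite.op_mul, T_mul, mul_inv_rev]
      rw [← mul_inv_rev, len_inv, len_inv, len_inv, h, add_comm])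
    (fun s hs => by
      have h := congrArg MulOpposite.op (T_quad hs)
      rw [MulOpposite.op_mul, MulOpposite.op_zero, MulOpposite.op_sub, MulOpposite.op_add,
        MulOpposite.op_one] at h
      rw [simple_inv hs, ← h, MulOpposite.algebraMap_apply]
      simp only [add_mul, mul_sub, mul_add, sub_mul, one_mul, mul_one]
      simp only [← MulOpposite.op_mul, Algebra.commutes q (T s)]
      abel)

/-- The anti-involution `T_w ↦ T_{w⁻¹}`. -/
def antiInv (r : ℕ) [NeZero r] : Hecke r →ₗ[𝓐] Hecke r :=
  (MulOpposite.opLinearEquiv 𝓐).symm.toLinearMap.comp (antiInvHom r).toLinearMap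

lemma antiInv_T (w : W r) : antiInv r (T w) = T w⁻¹ := by
  show MulOpposite.unop (antiInvHom r (T w)) = _
  rw [antiInvHom, Hecke.lift_T, MulOpposite.unop_op]

lemma antiInv_mul (a b : Hecke r) : antiInv r (a * b) = antiInv r b * antiInv r a := by
  show MulOpposite.unop (antiInvHom r (a * b)) = _
  rw [map_mul, MulOpposite.unop_mul]
  rfl

lemma antiInv_one : antiInv r 1 = 1 := by
  rw [← T_one, antiInv_T, inv_one]

lemma antiInv_antiInv (h : Hecke r) : antiInv r (antiInv r h) = h := by
  have : (antiInv r).comp (antiInv r) = LinearMap.id :=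
    hecke_linear_ext fun w => by simp [antiInv_T]
  exact LinearMap.congr_fun this h

lemma coef_antiInv (w : W r) (h : Hecke r) : coef w (antiInv r h) = coef w⁻¹ h := by
  classical
  have : (coef w).comp (antiInv r) = coef w⁻¹ := hecke_linear_ext fun v => by
    simp [antiInv_T, coef_T, inv_eq_iff_eq_inv]
  exact LinearMap.congr_fun this h

end AntiInvolution

/-! ### The bar involution -/

section Bar

variable {r : ℕ} [NeZero r]

lemma isUnit_T (w : W r) : IsUnit (T w) := by
  refine len_induction_left (P := fun w => IsUnit (T w)) (fun k => ?_) (fun s hs w hl ih => ?_) w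
  · refine ⟨⟨T (shift r ^ k), T (shift r ^ (-k)), ?_, ?_⟩, rfl⟩
    · rw [T_shift_mul, ← zpow_add]; simp [T_one]
    · rw [T_shift_mul, ← zpow_add]; simp [T_one]
  · rw [← T_simple_mul_of_lt hs (by omega)]
    refine IsUnit.mul ?_ ih
    -- The quadratic relation gives the inverse `q⁻¹ T_s + (q⁻¹ - 1)`.
    refine ⟨⟨T s, tpow (-2) • T s + (tpow (-2) - 1) • 1, ?_, ?_⟩, rfl⟩
    · rw [mul_add, mul_smul_comm, mul_smul_comm, T_sq hs, mul_one, smul_add, smul_smul, smul_smul,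
        mul_sub, tpow_mul_q]
      module
    · rw [add_mul, smul_mul_assoc, smul_mul_assoc, T_sq hs, one_mul, smul_add, smul_smul,
        smul_smul, mul_sub, tpow_mul_q]
      module

lemma inverse_mul {M : Type*} [MonoidWithZero M] {a b : M} (ha : IsUnit a) (hb : IsUnit b) :
    Ring.inverse (a * b) = Ring.inverse b * Ring.inverse a := by
  obtain ⟨u, rfl⟩ := ha
  obtain ⟨v, rfl⟩ := hb
  rw [← Units.val_mul, Ring.inverse_unit, Ring.inverse_unit, Ring.inverse_unit, mul_inv_rev,
    Units.val_mul]

lemma inverse_eq_of_mul_eq_one {M : Type*} [MonoidWithZero M] {a b : M} (ha : IsUnit a)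
    (h : a * b = 1) : Ring.inverse a = b := by
  obtain ⟨u, rfl⟩ := ha
  rw [Ring.inverse_unit]
  exact Units.inv_eq_of_mul_eq_one_right h

lemma inverse_T_simple {s : W r} (hs : s ∈ simpleRefl r) :
    Ring.inverse (T s) = tpow (-2) • T s + (tpow (-2) - 1) • (1 : Hecke r) := by
  refine inverse_eq_of_mul_eq_one (isUnit_T s) ?_
  rw [mul_add, mul_smul_comm, mul_smul_comm, T_sq hs, mul_one, smul_add, smul_smul, smul_smul,
    mul_sub, tpow_mul_q]
  module

/-- The Hecke algebra with scalars twisted by `t ↦ t⁻¹`. -/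
def TwistedHecke (r : ℕ) : Type := Hecke r

instance : Ring (TwistedHecke r) := inferInstanceAs (Ring (Hecke r))

instance : Algebra 𝓐 (TwistedHecke r) :=
  RingHom.toAlgebra' (S := Hecke r) ((algebraMap 𝓐 (Hecke r)).comp
    (LaurentPolynomial.invert (R := ℤ) : 𝓐 →+* 𝓐)) fun c x =>
      Algebra.commutes (A := Hecke r) (LaurentPolynomial.invert c) x

/-- The bar involution, as an algebra homomorphism to the twisted algebra. -/
def barHom (r : ℕ) [NeZero r] : Hecke r →ₐ[𝓐] TwistedHecke r :=
  Hecke.lift (A := TwistedHecke r) (fun w => (Ring.inverse (T w⁻¹) : Hecke r))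
    (by
      show (Ring.inverse (T 1⁻¹) : Hecke r) = 1
      rw [inv_one, T_one, Ring.inverse_one])
    (fun w w' h => by
      show (Ring.inverse (T w⁻¹) * Ring.inverse (T w'⁻¹) : Hecke r) = Ring.inverse (T (w * w')⁻¹)
      rw [← inverse_mul (isUnit_T _) (isUnit_T _), T_mul, mul_inv_rev]
      rw [← mul_inv_rev, len_inv, len_inv, len_inv, h, add_comm])
    (fun s hs => by
      show (Ring.inverse (T s⁻¹) + 1) * (Ring.inverse (T s⁻¹) -
        algebraMap 𝓐 (Hecke r) (LaurentPolynomial.invert q)) = 0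
      rw [simple_inv hs, inverse_T_simple hs, q, invert_tpow, Algebra.algebraMap_eq_smul_one]
      have h := T_quad hs
      rw [Algebra.algebraMap_eq_smul_one] at h
      have e1 : tpow (-2) • T s + (tpow (-2) - 1) • (1 : Hecke r) + 1 =
          tpow (-2) • (T s + 1) := by module
      have e2 : tpow (-2) • T s + (tpow (-2) - 1) • (1 : Hecke r) - tpow (-2) • 1 =
          tpow (-2) • (T s - q • 1) := by
        rw [smul_sub, smul_smul, tpow_mul_q]; module
      rw [e1, e2, smul_mul_assoc, mul_smul_comm, h, smul_zero, smul_zero])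

lemma barHom_T (w : W r) : barHom r (T w) = (Ring.inverse (T w⁻¹) : Hecke r) :=
  Hecke.lift_T (A := TwistedHecke r) _ _ _ _ w

/-- Twisting the scalars of the target turns the semilinear bar map into an algebra homomorphism.
The universal property yields existence, and agreement on the basis `T_w` yields uniqueness. -/
lemma existsUnique_isBar : ∃! f : Hecke r →+* Hecke r, IsBar f := by
  refine ⟨((barHom r : Hecke r →ₐ[𝓐] TwistedHecke r) : Hecke r →+* TwistedHecke r),
    ⟨fun a => (barHom r).commutes a, barHom_T⟩, fun f hf => ?_⟩
  refine RingHom.ext fun h => ?_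
  let f' : Hecke r →ₐ[𝓐] TwistedHecke r := { f with commutes' := hf.1 }
  have : f'.toLinearMap = (barHom r).toLinearMap := hecke_linear_ext fun w =>
    (hf.2 w).trans (barHom_T w).symm
  exact LinearMap.congr_fun this h

lemma isBar_bar : IsBar (bar r) := theUnique_spec existsUnique_isBar

lemma bar_eq {f : Hecke r →+* Hecke r} (hf : IsBar f) : f = bar r :=
  existsUnique_isBar.unique hf isBar_bar

lemma bar_T (w : W r) : bar r (T w) = Ring.inverse (T w⁻¹) := isBar_bar.2 w

lemma bar_smul (a : 𝓐) (h : Hecke r) :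
    bar r (a • h) = LaurentPolynomial.invert a • bar r h := by
  rw [Algebra.smul_def, map_mul, isBar_bar.1, ← Algebra.smul_def]

lemma bar_T_simple {s : W r} (hs : s ∈ simpleRefl r) :
    bar r (T s) = tpow (-2) • T s + (tpow (-2) - 1) • (1 : Hecke r) := by
  rw [bar_T, simple_inv hs, inverse_T_simple hs]

lemma bar_T_shift (k : ℤ) : bar r (T (shift r ^ k)) = T (shift r ^ k) := by
  rw [bar_T]
  refine inverse_eq_of_mul_eq_one (isUnit_T _) ?_
  rw [← zpow_neg, T_shift_mul, ← zpow_add]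
  simp [T_one]

/-- Conjugating the bar involution by the anti-involution gives a map with the same defining
properties, so uniqueness applies. -/
lemma bar_antiInv (h : Hecke r) : bar r (antiInv r h) = antiInv r (bar r h) := by
  let f : Hecke r →+* Hecke r :=
    { toFun := fun h => antiInv r (bar r (antiInv r h))
      map_one' := by simp [antiInv_one]
      map_mul' := fun a b => by simp only [antiInv_mul, map_mul]
      map_zero' := by simp
      map_add' := fun a b => by simp only [map_add] }
  have hf : IsBar f := by
    constructor
    · intro a
      show antiInv r (bar r (antiInv r (algebraMap 𝓐 (Hecke r) a))) = _
      rw [Algebra.algebraMap_eq_smul_one, map_smul, antiInv_one, bar_smul, map_one, map_smul,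
        antiInv_one, ← Algebra.algebraMap_eq_smul_one]
    · intro w
      show antiInv r (bar r (antiInv r (T w))) = _
      rw [antiInv_T, bar_T, inv_inv]
      refine (inverse_eq_of_mul_eq_one (isUnit_T _) ?_).symm
      rw [← antiInv_T, ← antiInv_mul, Ring.inverse_mul_cancel _ (isUnit_T w), antiInv_one]
  have h1 := RingHom.congr_fun (bar_eq hf) h
  rw [← h1]
  exact (antiInv_antiInv _).symm

open Classical in
/-- The bar involution is unitriangular up to units with respect to the length. -/
lemma coef_bar_T (z y : W r) (h : len z ≤ len y) :
    coef y (bar r (T z)) = if z = y then tpow (-2 * len z) else 0 := by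
  refine len_induction_left (P := fun z => ∀ y, len z ≤ len y →
    coef y (bar r (T z)) = if z = y then tpow (-2 * len z) else 0) (fun k y _ => ?_)
    (fun s hs w hl ih y hy => ?_) z y h
  · rw [bar_T_shift, coef_T, len_shift_zpow]
    simp [tpow_zero]
  · have h0 : coef y (bar r (T w)) = 0 := by
      rw [ih y (by omega), if_neg]
      intro h
      rw [← h] at hy
      omega
    have e : s * w = y ↔ w = s * y := by
      constructor
      · rintro rfl; rw [simple_mul_cancel hs]
      · rintro rfl; rw [simple_mul_cancel hs]
    rw [← T_simple_mul_of_lt hs (by omega), map_mul, bar_T_simple hs, add_mul, smul_mul_assoc,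
      smul_mul_assoc, one_mul, map_add, map_smul, map_smul, coef_simple_mul hs, h0, smul_zero,
      mul_zero, add_zero, add_zero]
    simp only [e]
    by_cases h1 : len y < len (s * y)
    · have h2 : w ≠ s * y := by
        intro h
        have := congrArg len h
        omega
      rw [if_pos h1, ih _ (by omega), if_neg h2, if_neg h2, mul_zero, smul_zero]
    · have := len_simple_mul hs y
      rw [if_neg h1, ih _ (by omega), hl]
      split_ifs
      · rw [smul_eq_mul, ← tpow_add]; congr 1; push_cast; ring
      · rw [smul_zero]

/-- A bar invariant element whose coefficients have only sufficiently negative exponents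
vanishes. -/
lemma eq_zero_of_bar_eq {h : Hecke r} (hbar : bar r h = h)
    (hneg : ∀ y k, (coef y h).coeff k ≠ 0 → k + len y < 0) : h = 0 := by
  classical
  by_contra hne
  have hs : (supp h).Nonempty := by
    by_contra hs
    rw [Finset.not_nonempty_iff_eq_empty] at hs
    exact hne (by rw [eq_sum_supp h, hs, Finset.sum_empty])
  obtain ⟨y, hy, hmax⟩ := (supp h).exists_max_image len hs
  -- At a longest `y` of the support only `T_y` itself contributes to the coefficient of the bar
  -- image. The set of exponents `k` occurring there is thus symmetric under `k ↦ -2 l(y) - k`,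
  -- while all of them are less than `-l(y)`.
  have e : coef y h = LaurentPolynomial.invert (coef y h) * tpow (-2 * len y) := by
    conv_lhs => rw [← hbar, eq_sum_supp h, map_sum, map_sum]
    rw [Finset.sum_eq_single_of_mem y hy]
    · rw [bar_smul, map_smul, coef_bar_T y y le_rfl, if_pos rfl, smul_eq_mul]
    · intro z hz hzy
      rw [bar_smul, map_smul, coef_bar_T z y (hmax z hz), if_neg hzy, smul_zero]
  refine mem_supp.1 hy (LaurentPolynomial.ext fun k => ?_)
  by_contra hk
  have h1 := hneg y k hk
  rw [e, mul_comm, coeff_tpow_mul, LaurentPolynomial.invert_apply] at hk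
  have h2 := hneg y _ hk
  omega

end Bar

/-! ### The Kazhdan-Lusztig basis -/

lemma coeff_aeval_q (P : Polynomial ℤ) (k : ℤ) :
    (Polynomial.aeval q P).coeff k = if 0 ≤ k ∧ 2 ∣ k then P.coeff (k / 2).toNat else 0 := by
  induction P using Polynomial.induction_on' with
  | add P Q hP hQ =>
    rw [map_add, AddMonoidAlgebra.coeff_add, Finsupp.add_apply, hP, hQ, Polynomial.coeff_add]
    split_ifs <;> simp
  | monomial n a =>
    have e : Polynomial.aeval q (Polynomial.monomial n a) = LaurentPolynomial.C a * tpow (2 * n) := by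
      rw [Polynomial.aeval_monomial, q, tpow, LaurentPolynomial.T_pow, ← tpow, mul_comm (n : ℤ)]
      rfl
    rw [e, mul_comm, coeff_tpow_mul, LaurentPolynomial.C_apply, Polynomial.coeff_monomial]
    by_cases h : k - 2 * n = 0
    · rw [if_pos h, if_pos (by omega), if_pos (by omega)]
    · rw [if_neg h]
      split_ifs <;> first | rfl | omega

/-- The coefficient of `t^k`, as an additive map. -/
def coeffHom (k : ℤ) : 𝓐 →+ ℤ where
  toFun f := f.coeff k
  map_zero' := rfl
  map_add' _ _ := rfl

lemma coeffHom_apply (k : ℤ) (f : 𝓐) : coeffHom k f = f.coeff k := rfl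

lemma coeff_tpow (m k : ℤ) : (tpow m).coeff k = if m = k then 1 else 0 :=
  LaurentPolynomial.T_apply k m

section KL

variable {r : ℕ} [NeZero r]

/-- The condition on the coefficients of `C_w` with respect to the basis `{T_y}`, in terms of the
exponents of `t` that occur. -/
structure KLCoeffs (w : W r) (h : Hecke r) : Prop where
  self : coef w h = tpow (-len w)
  le : ∀ {y k}, (coef y h).coeff k ≠ 0 → bruhatLE y w
  lower : ∀ {y k}, (coef y h).coeff k ≠ 0 → -(len w : ℤ) ≤ k
  parity : ∀ {y k}, (coef y h).coeff k ≠ 0 → 2 ∣ k + len w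
  upper : ∀ {y k}, (coef y h).coeff k ≠ 0 → y ≠ w → k + len y < 0

lemma KLCoeffs.exponent_self {w : W r} {h : Hecke r} (H : KLCoeffs w h) {k : ℤ}
    (hk : (coef w h).coeff k ≠ 0) : k = -len w := by
  rw [H.self, coeff_tpow] at hk
  by_contra hne
  exact hk (if_neg (Ne.symm hne))

lemma KLCoeffs.coef_eq_zero {w y : W r} {h : Hecke r} (H : KLCoeffs w h) (hy : ¬ bruhatLE y w) :
    coef y h = 0 := by
  refine LaurentPolynomial.ext fun k => ?_
  by_contra hk
  exact hy (H.le hk)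

open Classical in
lemma coef_finsum (w y : W r) (f : W r → 𝓐) :
    coef y (∑ᶠ x ∈ {x | bruhatLE x w}, f x • T x) = if bruhatLE y w then f y else 0 := by
  rw [finsum_mem_eq_finite_toFinset_sum _ (finite_bruhatLE w), map_sum]
  simp only [map_smul, coef_T, smul_eq_mul, mul_ite, mul_one, mul_zero]
  rw [Finset.sum_ite_eq']
  simp

/-- A term `q^j` of `P_{y,w}` contributes `t^(2j - l(w))`. Being a polynomial in `q` becomes `lower`
and `parity`, and the degree bound becomes `upper`. -/
lemma isKL_iff {w : W r} {h : Hecke r} : IsKL w h ↔ bar r h = h ∧ KLCoeffs w h := by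
  classical
  refine and_congr_right fun _ => ⟨?_, fun H => ?_⟩
  · rintro ⟨P, h1, h2, h3⟩
    have hc : ∀ y, coef y h =
        tpow (-len w) * if bruhatLE y w then Polynomial.aeval q (P y) else 0 := fun y => by
      rw [h3, map_smul, coef_finsum, smul_eq_mul]
    have key : ∀ {y k}, (coef y h).coeff k ≠ 0 → bruhatLE y w ∧ 0 ≤ k + len w ∧ 2 ∣ k + len w ∧
        (P y).coeff ((k + len w) / 2).toNat ≠ 0 := fun {y k} hk => by
      rw [hc, coeff_tpow_mul] at hk
      by_cases hy : bruhatLE y w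
      · rw [if_pos hy, coeff_aeval_q, sub_neg_eq_add] at hk
        have h4 := (ite_ne_right_iff.1 hk)
        exact ⟨hy, h4.1.1, h4.1.2, h4.2⟩
      · simp [hy] at hk
    refine ⟨?_, fun hk => (key hk).1, fun hk => by have := (key hk).2.1; omega,
      fun hk => (key hk).2.2.1, fun {y k} hk hne => ?_⟩
    · rw [hc, if_pos (bruhatLE_refl w), h1, map_one, mul_one]
    · obtain ⟨h4, h5, h6, h7⟩ := key hk
      have h8 := Polynomial.le_natDegree_of_ne_zero h7
      have h9 := h2 y h4 hne
      omega
  -- Exponents in `h` are at most `-l(y) ≤ 0`, so `j ≤ l(w)` captures all of them.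
  · let P : W r → Polynomial ℤ := fun y => ∑ j ∈ Finset.range (len w + 1),
      Polynomial.monomial j ((coef y h).coeff (2 * j - len w))
    have hP : ∀ y j, (P y).coeff j =
        if j < len w + 1 then (coef y h).coeff (2 * j - len w) else 0 := fun y j => by
      simp only [P, Polynomial.finsetSum_coeff, Polynomial.coeff_monomial, Finset.sum_ite_eq',
        Finset.mem_range]
    have hP' : ∀ {y j}, (P y).coeff j ≠ 0 → (coef y h).coeff (2 * j - len w) ≠ 0 :=
      fun {y j} hj => by
        rw [hP] at hj
        exact (ite_ne_right_iff.1 hj).2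
    refine ⟨P, ?_, fun y hy hne => ?_, ?_⟩
    · ext j
      rw [hP, H.self, coeff_tpow, Polynomial.coeff_one]
      split_ifs <;> omega
    · by_cases h0 : P y = 0
      · rw [h0, Polynomial.natDegree_zero]
        have := hy.len_lt hne
        omega
      · have := H.upper (hP' (Polynomial.leadingCoeff_ne_zero.2 h0)) hne
        omega
    · refine hecke_ext fun y => LaurentPolynomial.ext fun k => ?_
      rw [map_smul, coef_finsum, smul_eq_mul]
      by_cases hy : bruhatLE y w
      · rw [if_pos hy, coeff_tpow_mul, coeff_aeval_q, hP, sub_neg_eq_add]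
        by_cases hk : (coef y h).coeff k = 0
        · split_ifs with h1 h2
          · rw [show 2 * (((k + len w) / 2).toNat : ℤ) - len w = k by omega]
          · exact hk
          · exact hk
        · have h1 := H.lower hk
          have h2 := H.parity hk
          have h3 : k + len y ≤ 0 := by
            by_cases hne : y = w
            · subst hne
              have := H.exponent_self hk
              omega
            · exact (H.upper hk hne).le
          rw [if_pos (by omega), if_pos (by omega),
            show 2 * (((k + len w) / 2).toNat : ℤ) - len w = k by omega]
      · rw [if_neg hy, mul_zero, H.coef_eq_zero hy]

/-- The difference has no coefficient at `w`, and all its exponents satisfy `k + l(y) < 0`, so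
`eq_zero_of_bar_eq` kills it. -/
lemma KLCoeffs.unique {w : W r} {h h' : Hecke r} (H : KLCoeffs w h) (H' : KLCoeffs w h')
    (hb : bar r h = h) (hb' : bar r h' = h') : h = h' := by
  refine sub_eq_zero.1 (eq_zero_of_bar_eq (by rw [map_sub, hb, hb']) fun y k hk => ?_)
  have hne : y ≠ w := by
    rintro rfl
    rw [map_sub, H.self, H'.self, sub_self] at hk
    exact hk rfl
  rw [map_sub, ← coeffHom_apply, map_sub, coeffHom_apply, coeffHom_apply] at hk
  by_cases h1 : (coef y h).coeff k = 0
  · exact H'.upper (fun h2 => hk (by rw [h1, h2, sub_zero])) hne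
  · exact H.upper h1 hne

lemma klCoeffs_shift (k : ℤ) : KLCoeffs (shift r ^ k) (T (shift r ^ k)) := by
  classical
  have key : ∀ {y : W r} {m : ℤ}, (coef y (T (shift r ^ k))).coeff m ≠ 0 →
      y = shift r ^ k ∧ m = 0 := by
    intro y m hm
    rw [coef_T] at hm
    by_cases hy : shift r ^ k = y
    · rw [if_pos hy, ← tpow_zero, coeff_tpow] at hm
      exact ⟨hy.symm, (ite_ne_right_iff.1 hm).1.symm⟩
    · rw [if_neg hy] at hm
      exact absurd rfl hm
  refine ⟨?_, fun h => (key h).1 ▸ bruhatLE_refl _, fun h => ?_, fun h => ?_,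
    fun h hne => absurd (key h).1 hne⟩
  · rw [coef_T, if_pos rfl, len_shift_zpow]
    simp [tpow_zero]
  · rw [(key h).2, len_shift_zpow]; simp
  · rw [(key h).2, len_shift_zpow]; simp

/-! ### Existence of the Kazhdan–Lusztig elements. -/

/-- The product `C_s h`. -/
def simpleStep (s : W r) (h : Hecke r) : Hecke r := tpow (-1) • (T s * h + h)

lemma bar_simpleStep {s : W r} (hs : s ∈ simpleRefl r) {h : Hecke r} (hb : bar r h = h) :
    bar r (simpleStep s h) = simpleStep s h := by
  have e : bar r (T s * h + h) = tpow (-2) • (T s * h + h) := by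
    rw [map_add, map_mul, bar_T_simple hs, hb, add_mul, smul_mul_assoc, smul_mul_assoc, one_mul]
    module
  rw [simpleStep, bar_smul, e, invert_tpow, smul_smul, ← tpow_add]
  norm_num

lemma T_mul_simpleStep {s : W r} (hs : s ∈ simpleRefl r) (h : Hecke r) :
    T s * simpleStep s h = q • simpleStep s h := by
  rw [simpleStep, mul_smul_comm, mul_add, ← mul_assoc, T_sq hs, add_mul, smul_mul_assoc,
    smul_mul_assoc, one_mul]
  module

lemma coeff_simpleStep_of_lt {s y : W r} (hs : s ∈ simpleRefl r) (hy : len y < len (s * y))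
    (h : Hecke r) (k : ℤ) : (coef y (simpleStep s h)).coeff k =
      (coef (s * y) h).coeff (k - 1) + (coef y h).coeff (k + 1) := by
  rw [simpleStep, map_smul, map_add, coef_simple_mul hs, if_pos hy, smul_eq_mul, mul_add,
    ← mul_assoc, q, ← tpow_add, ← coeffHom_apply, map_add, coeffHom_apply, coeffHom_apply,
    coeff_tpow_mul, coeff_tpow_mul]
  norm_num

lemma coeff_simpleStep_of_not_lt {s y : W r} (hs : s ∈ simpleRefl r)
    (hy : ¬ len y < len (s * y)) (h : Hecke r) (k : ℤ) : (coef y (simpleStep s h)).coeff k =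
      (coef (s * y) h).coeff (k + 1) + (coef y h).coeff (k - 1) := by
  have e : coef y (simpleStep s h) = tpow (-1) * coef (s * y) h + tpow 1 * coef y h := by
    rw [simpleStep, map_smul, map_add, coef_simple_mul hs, if_neg hy, smul_eq_mul,
      show tpow 1 = tpow (-1) * q by rw [q, ← tpow_add]; norm_num]
    ring
  rw [e, ← coeffHom_apply, map_add, coeffHom_apply, coeffHom_apply, coeff_tpow_mul,
    coeff_tpow_mul]
  norm_num

/-- The exponents that occur in `C_s C_v`. -/
lemma exponents_simpleStep {s v : W r} (hs : s ∈ simpleRefl r) (hv : len v < len (s * v))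
    {h : Hecke r} (H : KLCoeffs v h) {y : W r} {k : ℤ}
    (hk : (coef y (simpleStep s h)).coeff k ≠ 0) :
    bruhatLE y (s * v) ∧ -(len (s * v) : ℤ) ≤ k ∧ 2 ∣ k + len (s * v) ∧ k + len y ≤ 0 ∧
      (y ≠ s * v → k + len y = 0 → len y < len (s * v) ∧ len (s * y) < len y) := by
  have hv' := len_simple_mul hs v
  have hy' := len_simple_mul hs y
  have hvw := bruhatLE_simple_mul hs hv
  by_cases hy : len y < len (s * y)
  · rw [coeff_simpleStep_of_lt hs hy] at hk
    by_cases h1 : (coef (s * y) h).coeff (k - 1) = 0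
    · have h2 : (coef y h).coeff (k + 1) ≠ 0 := fun h2 => hk (by rw [h1, h2, add_zero])
      have a1 := H.le h2
      have a2 := H.lower h2
      have a3 := H.parity h2
      have a4 : k + len y < 0 := by
        by_cases hyv : y = v
        · subst hyv
          have := H.exponent_self h2
          omega
        · have := H.upper h2 hyv
          omega
      exact ⟨a1.trans hvw, by omega, by omega, a4.le, fun _ h => by omega⟩
    · have a1 := H.le h1
      have a2 := H.lower h1
      have a3 := H.parity h1
      have a4 := H.upper h1 (by
        rintro rfl
        rw [simple_mul_cancel hs] at hv
        omega)
      exact ⟨((bruhatLE_simple_mul hs hy).trans a1).trans hvw, by omega, by omega, by omega,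
        fun _ h => by omega⟩
  · rw [coeff_simpleStep_of_not_lt hs hy] at hk
    by_cases h1 : (coef (s * y) h).coeff (k + 1) = 0
    · have h2 : (coef y h).coeff (k - 1) ≠ 0 := fun h2 => hk (by rw [h1, h2, add_zero])
      have a1 := H.le h2
      have a2 := H.lower h2
      have a3 := H.parity h2
      have a4 := H.upper h2 (by rintro rfl; exact hy hv)
      have a5 := a1.len_le
      exact ⟨a1.trans hvw, by omega, by omega, by omega, fun _ h => by omega⟩
    · have a1 := H.le h1
      have a2 := H.lower h1
      have a3 := H.parity h1
      have a5 := a1.simple_mul hs hv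
      rw [simple_mul_cancel hs] at a5
      by_cases hyv : s * y = v
      · subst hyv
        have := H.exponent_self h1
        rw [simple_mul_cancel hs] at *
        exact ⟨bruhatLE_refl _, by omega, by omega, by omega, fun h => absurd rfl h⟩
      · have a4 := H.upper h1 hyv
        exact ⟨a5, by omega, by omega, by omega, fun _ h => by omega⟩

lemma coef_simpleStep_self {s v : W r} (hs : s ∈ simpleRefl r) (hv : len v < len (s * v))
    {h : Hecke r} (H : KLCoeffs v h) : coef (s * v) (simpleStep s h) = tpow (-len (s * v)) := by
  have hv' := len_simple_mul hs v
  refine LaurentPolynomial.ext fun k => ?_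
  rw [coeff_simpleStep_of_not_lt hs (by rw [simple_mul_cancel hs]; omega), simple_mul_cancel hs,
    H.self, H.coef_eq_zero (fun h => by have := h.len_le; omega), coeff_tpow, coeff_tpow]
  have e : (-(len v : ℤ) = k + 1) ↔ (-(len (s * v) : ℤ) = k) := by omega
  simp [e]

/-- The Kazhdan–Lusztig recursion: `C_s C_v` is bar invariant and violates the degree bound only at
the boundary exponents `t^{-l(z)}`, for `z` shorter than `s v` with `s z` shorter than `z`.
Subtracting integer multiples of `C_z` repairs this, and each such `C_z` is an eigenvector of `T_s`,
as `C_s C_v` is. -/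
lemma exists_kl_step {s v : W r} (hs : s ∈ simpleRefl r) (hv : len v < len (s * v))
    (ih : ∀ z : W r, len z < len (s * v) → ∃ h, bar r h = h ∧ KLCoeffs z h ∧
      ∀ s' ∈ simpleRefl r, len (s' * z) < len z → T s' * h = q • h) :
    ∃ h, bar r h = h ∧ KLCoeffs (s * v) h ∧ T s * h = q • h := by
  classical
  obtain ⟨hv0, hb, H, -⟩ := ih v hv
  choose! K hKb hK hKs using ih
  set w := s * v with hw
  set E := simpleStep s hv0 with hE
  let F : Finset (W r) := (supp E).filter fun z => len z < len w ∧ len (s * z) < len z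
  have hF : ∀ {z}, z ∈ F → len z < len w ∧ len (s * z) < len z := fun hz =>
    (Finset.mem_filter.1 hz).2
  -- These multiplicities are integers, hence bar invariant scalars.
  let m : W r → ℤ := fun z => (coef z E).coeff (-len z)
  have hcoef : ∀ y, coef y (E - ∑ z ∈ F, m z • K z) =
      coef y E - ∑ z ∈ F, m z • coef y (K z) := fun y => by
    rw [map_sub, map_sum]
    simp only [map_zsmul]
  have hcoeff : ∀ y k, (coef y (E - ∑ z ∈ F, m z • K z)).coeff k =
      (coef y E).coeff k - ∑ z ∈ F, m z * (coef y (K z)).coeff k := fun y k => by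
    rw [hcoef, ← coeffHom_apply, map_sub, map_sum]
    simp only [map_zsmul, coeffHom_apply, smul_eq_mul]
  have hEexp : ∀ {y k}, (coef y E).coeff k ≠ 0 → _ := fun {y k} hk =>
    exponents_simpleStep hs hv H (y := y) (k := k) hk
  have hnz : ∀ {y k}, (coef y (E - ∑ z ∈ F, m z • K z)).coeff k ≠ 0 →
      bruhatLE y w ∧ -(len w : ℤ) ≤ k ∧ 2 ∣ k + len w ∧ k + len y ≤ 0 := by
    intro y k hk
    rw [hcoeff] at hk
    by_cases h1 : (coef y E).coeff k = 0
    · rw [h1, zero_sub, neg_ne_zero] at hk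
      obtain ⟨z, hz, hz'⟩ := Finset.exists_ne_zero_of_sum_ne_zero hk
      have hm : (coef z E).coeff (-len z) ≠ 0 := left_ne_zero_of_mul hz'
      have hc := right_ne_zero_of_mul hz'
      obtain ⟨b1, b2, b3, -, -⟩ := hEexp hm
      rw [← hw] at b1 b2 b3
      have Hz := hK z (hF hz).1
      have a1 := Hz.le hc
      have a2 := Hz.lower hc
      have a3 := Hz.parity hc
      have a4 : k + len y ≤ 0 := by
        by_cases hyz : y = z
        · subst hyz
          have := Hz.exponent_self hc
          omega
        · exact (Hz.upper hc hyz).le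
      exact ⟨a1.trans b1, by omega, by omega, a4⟩
    · obtain ⟨b1, b2, b3, b4, -⟩ := hEexp h1
      exact ⟨b1, b2, b3, b4⟩
  refine ⟨E - ∑ z ∈ F, m z • K z, ?_, ⟨?_, fun hk => (hnz hk).1, fun hk => (hnz hk).2.1,
    fun hk => (hnz hk).2.2.1, fun {y k} hk hne => ?_⟩, ?_⟩
  · rw [map_sub, bar_simpleStep hs hb, map_sum]
    congr 1
    refine Finset.sum_congr rfl fun z hz => ?_
    rw [map_zsmul, hKb z (hF hz).1]
  · rw [hcoef, Finset.sum_eq_zero, sub_zero, hE, hw, coef_simpleStep_self hs hv H]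
    intro z hz
    rw [(hK z (hF hz).1).coef_eq_zero, smul_zero]
    intro h
    have := h.len_le
    have := (hF hz).1
    omega
  · refine lt_of_le_of_ne (hnz hk).2.2.2 fun h0 => hk ?_
    obtain rfl : k = -len y := by omega
    -- At exponent `-l(y)` the only correction term that contributes is the one with `z = y`,
    -- because of `upper` for the others.
    have hsum : ∑ z ∈ F, m z * (coef y (K z)).coeff (-len y) = if y ∈ F then m y else 0 := by
      rw [← Finset.sum_ite_eq' F y m]
      refine Finset.sum_congr rfl fun z hz => ?_
      split_ifs with hzy
      · subst hzy
        rw [(hK z (hF hz).1).self, coeff_tpow, if_pos rfl, mul_one]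
      · by_contra hne'
        have := (hK z (hF hz).1).upper (right_ne_zero_of_mul hne') (Ne.symm hzy)
        omega
    rw [hcoeff, hsum]
    split_ifs with hyF
    · exact sub_self _
    · rw [sub_zero]
      by_contra hne'
      refine hyF (Finset.mem_filter.2 ⟨mem_supp.2 ?_, (hEexp hne').2.2.2.2 hne h0⟩)
      intro h
      rw [h] at hne'
      exact hne' rfl
  · rw [mul_sub, T_mul_simpleStep hs, smul_sub, Finset.mul_sum, Finset.smul_sum]
    congr 1
    refine Finset.sum_congr rfl fun z hz => ?_
    rw [mul_smul_comm, hKs z (hF hz).1 s hs (hF hz).2, smul_comm]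

/-- The recursion can start from any left descent and gives the eigenvector equation for that
descent only. Uniqueness identifies the results, so one element satisfies all these equations, as
the induction needs. -/
lemma exists_kl (w : W r) : ∃ h, bar r h = h ∧ KLCoeffs w h ∧
    ∀ s ∈ simpleRefl r, len (s * w) < len w → T s * h = q • h := by
  induction hn : len w using Nat.strong_induction_on generalizing w with
  | _ n ih =>
    subst hn
    have step : ∀ s ∈ simpleRefl r, len (s * w) < len w →
        ∃ h, bar r h = h ∧ KLCoeffs w h ∧ T s * h = q • h := fun s hs hl => by
      have e := simple_mul_cancel hs w
      have := exists_kl_step (v := s * w) hs (by rwa [e]) fun z hz => ih _ (by rwa [e] at hz) z rfl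
      rwa [e] at this
    by_cases h0 : len w = 0
    · obtain ⟨k, rfl⟩ := eq_shift_of_len_eq_zero h0
      exact ⟨_, bar_T_shift k, klCoeffs_shift k, fun s _ h => by omega⟩
    · obtain ⟨s, hs, hl⟩ := exists_left_descent h0
      obtain ⟨h, hb, H, -⟩ := step s hs (by omega)
      refine ⟨h, hb, H, fun s' hs' hl' => ?_⟩
      obtain ⟨h', hb', H', hT⟩ := step s' hs' hl'
      rwa [H.unique H' hb hb']

lemma existsUnique_isKL (w : W r) : ∃! h, IsKL w h := by
  obtain ⟨h, hb, H, -⟩ := exists_kl w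
  exact ⟨h, isKL_iff.2 ⟨hb, H⟩, fun h' hh' => by
    obtain ⟨hb', H'⟩ := isKL_iff.1 hh'
    exact H'.unique H hb' hb⟩

lemma C_eq {w : W r} {h : Hecke r} (hb : bar r h = h) (H : KLCoeffs w h) : C w = h :=
  theUnique_eq (existsUnique_isKL w) (isKL_iff.2 ⟨hb, H⟩)

lemma bar_C (w : W r) : bar r (C w) = C w :=
  (isKL_iff.1 (theUnique_spec (d := 0) (existsUnique_isKL w))).1

lemma klCoeffs_C (w : W r) : KLCoeffs w (C w) :=
  (isKL_iff.1 (theUnique_spec (d := 0) (existsUnique_isKL w))).2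

lemma T_mul_C {s w : W r} (hs : s ∈ simpleRefl r) (h : len (s * w) < len w) :
    T s * C w = q • C w := by
  obtain ⟨c, hb, H, hT⟩ := exists_kl w
  rw [C_eq hb H]
  exact hT s hs h

/-- The image satisfies the characterization of `C_{w⁻¹}`. This transfers left eigenvector equations
to the right. -/
lemma antiInv_C (w : W r) : antiInv r (C w) = C w⁻¹ := by
  have H := klCoeffs_C w
  refine (C_eq (by rw [bar_antiInv, bar_C]) ⟨?_, fun hk => ?_, fun hk => ?_, fun hk => ?_,
    fun {y k} hk hne => ?_⟩).symm
  · rw [coef_antiInv, inv_inv, H.self, len_inv]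
  · rw [coef_antiInv] at hk
    simpa using (H.le hk).inv
  · rw [coef_antiInv] at hk
    rw [len_inv]
    exact H.lower hk
  · rw [coef_antiInv] at hk
    rw [len_inv]
    exact H.parity hk
  · rw [coef_antiInv] at hk
    rw [← len_inv]
    exact H.upper hk fun h => hne (by rw [← h, inv_inv])

lemma C_mul_T {s w : W r} (hs : s ∈ simpleRefl r) (h : len (w * s) < len w) :
    C w * T s = q • C w := by
  have h1 : len (s * w⁻¹) < len w⁻¹ := by
    rwa [len_inv, ← len_inv (s * w⁻¹), mul_inv_rev, inv_inv, simple_inv hs]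
  have := congrArg (antiInv r) (T_mul_C hs h1)
  rwa [antiInv_mul, map_smul, antiInv_C, inv_inv, antiInv_T, simple_inv hs] at this

end KL

/-! ### Sums over subsets of `W` -/

section TSum

variable {r : ℕ} [NeZero r]

open Classical in
lemma coef_TSum {X : Set (W r)} (hX : X.Finite) (w : W r) :
    coef w (TSum X) = if w ∈ X then 1 else 0 := by
  rw [TSum, finsum_mem_eq_finite_toFinset_sum _ hX, map_sum]
  simp only [coef_T]
  rw [Finset.sum_ite_eq']
  simp

lemma q_mul_cancel {a b : 𝓐} (h : q * a = q * b) : a = b := by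
  have := congrArg (tpow (-2) * ·) h
  simpa only [← mul_assoc, tpow_mul_q, one_mul] using this

/-- For `w` shorter than `s w`, comparing coefficients at `w` gives `q` times the claim, and `q` is
a unit. -/
lemma coef_eq_of_T_mul {s : W r} (hs : s ∈ simpleRefl r) {h : Hecke r} (H : T s * h = q • h)
    (w : W r) : coef (s * w) h = coef w h := by
  have key : ∀ w, len w < len (s * w) → coef (s * w) h = coef w h := fun w hw => by
    have := congrArg (coef w) H
    rw [coef_simple_mul hs, if_pos hw, map_smul, smul_eq_mul] at this
    exact q_mul_cancel this
  by_cases hw : len w < len (s * w)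
  · exact key w hw
  · have := key (s * w) (by
      have := len_simple_mul hs w
      rw [simple_mul_cancel hs]; omega)
    rw [simple_mul_cancel hs] at this
    exact this.symm

lemma coef_eq_of_mul_T {s : W r} (hs : s ∈ simpleRefl r) {h : Hecke r} (H : h * T s = q • h)
    (w : W r) : coef (w * s) h = coef w h := by
  have h1 := congrArg (antiInv r) H
  rw [antiInv_mul, antiInv_T, simple_inv hs, map_smul] at h1
  have := coef_eq_of_T_mul hs h1 w⁻¹
  rwa [coef_antiInv, coef_antiInv, mul_inv_rev, inv_inv, simple_inv hs] at this

lemma T_mul_TSum {s : W r} (hs : s ∈ simpleRefl r) {X : Set (W r)} (hX : X.Finite)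
    (h : ∀ x ∈ X, s * x ∈ X) : T s * TSum X = q • TSum X := by
  classical
  have e : ∀ w, s * w ∈ X ↔ w ∈ X := fun w =>
    ⟨fun hw => by simpa [simple_mul_cancel hs] using h _ hw, h w⟩
  refine hecke_ext fun w => ?_
  rw [coef_simple_mul hs, map_smul, coef_TSum hX, coef_TSum hX, smul_eq_mul]
  simp only [e]
  split_ifs <;> ring

lemma antiInv_TSum {X : Set (W r)} (hX : X.Finite) : antiInv r (TSum X) = TSum X⁻¹ := by
  refine hecke_ext fun w => ?_
  rw [coef_antiInv, coef_TSum hX, coef_TSum hX.inv]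
  by_cases h : w⁻¹ ∈ X
  · rw [if_pos h, if_pos (Set.mem_inv.2 h)]
  · rw [if_neg h, if_neg (mt Set.mem_inv.1 h)]

variable {n : ℕ}

lemma finite_young (l : Lam n r) : (young l : Set (W r)).Finite := by
  rw [young_eq_parabolic]
  exact finite_parabolic (isCutSet_cuts l)

lemma finite_dcoset (l m : Lam n r) (w : W r) : (dcoset l m w).Finite := by
  rw [dcoset_eq]
  exact finite_pdcoset (isCutSet_cuts l) (isCutSet_cuts m) w

lemma antiInv_xElt (l : Lam n r) : antiInv r (xElt l) = xElt l := by
  rw [xElt, antiInv_TSum (finite_young l)]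
  congr 1
  ext w
  simp

lemma xElt_mul_T_of_min (l : Lam n r) {x : W r} (hx : ∀ u ∈ young l, len x ≤ len (u * x)) :
    xElt l * T x = TSum ((· * x) '' (young l : Set (W r))) := by
  rw [TSum, finsum_mem_image (fun a _ b _ h => mul_right_cancel h), xElt, TSum]
  refine ((AddMonoidHom.mulRight (T x)).map_finsum_mem T (finite_young l)).trans ?_
  refine finsum_mem_congr rfl fun u hu => ?_
  rw [young_eq_parabolic] at hx hu
  exact T_mul (len_mul_of_min (isCutSet_cuts l) hx hu)

/-- A sum over a set that is stable under `W_λ` lies in `x_λ H`. -/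
lemma TSum_mem_range_mulLeft (l : Lam n r) {X : Set (W r)} (hX : X.Finite)
    (h : ∀ u ∈ young l, ∀ x ∈ X, u * x ∈ X) :
    TSum X ∈ LinearMap.range (LinearMap.mulLeft 𝓐 (xElt l)) := by
  classical
  induction hn : X.ncard using Nat.strong_induction_on generalizing X with
  | _ k ih =>
    rcases X.eq_empty_or_nonempty with rfl | hne
    · rw [TSum, finsum_mem_empty]
      exact zero_mem _
    -- A shortest element of `X` is shortest in its coset `W_λ x`, whose sum is therefore `x_λ T_x`.
    -- That coset is split off and induction handles the rest.
    obtain ⟨x, hx, hmin⟩ := Set.exists_min_image X len hX hne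
    set Y := (· * x) '' (young l : Set (W r)) with hY
    have hYX : Y ⊆ X := by
      rintro _ ⟨u, hu, rfl⟩
      exact h u hu x hx
    have hxY : x ∈ Y := ⟨1, one_mem _, one_mul x⟩
    have hXY : (X \ Y).Finite := hX.subset Set.sdiff_subset
    have hsum : TSum X = xElt l * T x + TSum (X \ Y) := by
      rw [xElt_mul_T_of_min l fun u hu => hmin _ (h u hu x hx), ← hY]
      refine hecke_ext fun w => ?_
      rw [map_add, coef_TSum hX, coef_TSum (hX.subset hYX), coef_TSum hXY]
      by_cases h1 : w ∈ Y
      · simp [h1, hYX h1]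
      · simp [h1]
    rw [hsum]
    refine add_mem ⟨T x, rfl⟩ (ih _ ?_ hXY (fun u hu y hy => ⟨h u hu y hy.1, ?_⟩) rfl)
    · rw [← hn]
      exact Set.ncard_lt_ncard ⟨Set.sdiff_subset, fun hsub => (hsub hx).2 hxY⟩ hX
    · rintro ⟨v, hv, hvy⟩
      refine hy.2 ⟨u⁻¹ * v, mul_mem (inv_mem hu) hv, ?_⟩
      show u⁻¹ * v * x = y
      rw [mul_assoc, show v * x = u * y from hvy, inv_mul_cancel_left]

lemma TSum_mem_range_mulRight (m : Lam n r) {X : Set (W r)} (hX : X.Finite)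
    (h : ∀ v ∈ young m, ∀ x ∈ X, x * v ∈ X) :
    TSum X ∈ LinearMap.range (LinearMap.mulRight 𝓐 (xElt m)) := by
  obtain ⟨g, hg⟩ := TSum_mem_range_mulLeft m hX.inv fun u hu x hx => by
    have := h u⁻¹ (inv_mem hu) _ hx
    rwa [Set.mem_inv, mul_inv_rev]
  refine ⟨antiInv r g, ?_⟩
  have := congrArg (antiInv r) hg
  rwa [LinearMap.mulLeft_apply, antiInv_mul, antiInv_xElt, antiInv_TSum hX.inv, inv_inv] at this

end TSum

/-! ### Elements that are constant on double cosets -/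

section BiInvariant

variable {r : ℕ} [NeZero r] {n : ℕ}

lemma mul_mem_dcoset {l m : Lam n r} {u v w x : W r} (hu : u ∈ young l) (hv : v ∈ young m) :
    u * x * v ∈ dcoset l m w ↔ x ∈ dcoset l m w := by
  rw [young_eq_parabolic] at hu hv
  rw [dcoset_eq, mul_mem_pdcoset_right hv, mul_mem_pdcoset_left hu]

lemma self_mem_dcoset (l m : Lam n r) (w : W r) : w ∈ dcoset l m w := by
  rw [dcoset_eq]
  exact self_mem_pdcoset w

lemma dcoset_eq_of_mem {l m : Lam n r} {w x : W r} (h : x ∈ dcoset l m w) :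
    dcoset l m x = dcoset l m w := by
  rw [dcoset_eq] at h
  rw [dcoset_eq, dcoset_eq, pdcoset_eq_of_mem h]

lemma plus_injOn {l m : Lam n r} {z z' : W r} (hz : z ∈ minReps l m) (hz' : z' ∈ minReps l m)
    (h : plus l m z' = plus l m z) : z' = z := by
  refine minReps_eq_of_mem hz hz' ?_
  rw [← dcoset_eq_of_mem (plus_spec l m z).1, ← h, dcoset_eq_of_mem (plus_spec l m z').1]
  exact self_mem_dcoset l m z'

/-- The elements whose coefficients are constant on the double cosets in `W_λ \ W / W_μ`. -/
def biInvariant (l m : Lam n r) : Submodule 𝓐 (Hecke r) where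
  carrier := {h | ∀ u ∈ young l, ∀ v ∈ young m, ∀ w, coef (u * w * v) h = coef w h}
  add_mem' := fun ha hb u hu v hv w => by rw [map_add, map_add, ha u hu v hv, hb u hu v hv]
  zero_mem' := fun u hu v hv w => by rw [map_zero, map_zero]
  smul_mem' := fun c a ha u hu v hv w => by rw [map_smul, map_smul, ha u hu v hv]

lemma mem_biInvariant_of_eigen {l m : Lam n r} {h : Hecke r}
    (hl : ∀ s ∈ simpleRefl r, s ∈ young l → T s * h = q • h)
    (hm : ∀ s ∈ simpleRefl r, s ∈ young m → h * T s = q • h) : h ∈ biInvariant l m := by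
  rw [young_eq_parabolic] at hl hm
  intro u hu v hv w
  rw [young_eq_parabolic] at hu hv
  have h1 : ∀ u ∈ parabolic r (cuts l), ∀ w, coef (u * w) h = coef w h :=
    parabolic_induction_left (isCutSet_cuts l) (by simp) fun s hs hsK u _ _ ih w => by
      rw [mul_assoc, coef_eq_of_T_mul hs (hl s hs hsK), ih]
  have h2 : ∀ v ∈ parabolic r (cuts m), ∀ w, coef (w * v) h = coef w h :=
    parabolic_induction_right (isCutSet_cuts m) (by simp) fun s hs hsK u _ _ ih w => by
      rw [← mul_assoc, coef_eq_of_mul_T hs (hm s hs hsK), ih]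
  rw [h2 v hv, h1 u hu]

lemma TSum_dcoset_mem_biInvariant (l m : Lam n r) (w : W r) :
    TSum (dcoset l m w) ∈ biInvariant l m := fun u hu v hv x => by
  rw [coef_TSum (finite_dcoset l m w), coef_TSum (finite_dcoset l m w)]
  by_cases h : x ∈ dcoset l m w
  · rw [if_pos h, if_pos ((mul_mem_dcoset hu hv).2 h)]
  · rw [if_neg h, if_neg (mt (mul_mem_dcoset hu hv).1 h)]

lemma coef_eq_of_mem_dcoset {l m : Lam n r} {h : Hecke r} (H : h ∈ biInvariant l m) {w x : W r}
    (hx : x ∈ dcoset l m w) : coef x h = coef w h := by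
  obtain ⟨u, hu, v, hv, rfl⟩ := DoubleCoset.mem_doubleCoset.1 hx
  exact H u hu v hv w

lemma C_plus_mem_biInvariant (l m : Lam n r) (w : W r) : C (plus l m w) ∈ biInvariant l m := by
  obtain ⟨h1, h2⟩ := plus_spec l m w
  refine mem_biInvariant_of_eigen (fun s hs hsl => T_mul_C hs ?_) (fun s hs hsm => C_mul_T hs ?_)
  · have h3 := h2 (s * plus l m w) (by simpa using (mul_mem_dcoset hsl (one_mem (young m))).2 h1)
    rcases len_simple_mul hs (plus l m w) with h | h <;> omega
  · have h3 := h2 (plus l m w * s) (by simpa using (mul_mem_dcoset (one_mem (young l)) hsm).2 h1)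
    rcases len_mul_simple hs (plus l m w) with h | h <;> omega

/-- The combination `∑_z a_z T_{W_λ z W_μ}`. -/
def dcosetSum (l m : Lam n r) (a : minReps l m →₀ 𝓐) : Hecke r :=
  a.sum fun z c => c • TSum (dcoset l m z.1)

lemma coef_dcosetSum (l m : Lam n r) (a : minReps l m →₀ 𝓐) (z : minReps l m) {w : W r}
    (hw : w ∈ dcoset l m z.1) : coef w (dcosetSum l m a) = a z := by
  classical
  rw [dcosetSum, Finsupp.sum, map_sum]
  have : ∀ z' ∈ a.support, coef w (a z' • TSum (dcoset l m z'.1)) =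
      if z' = z then a z' else 0 := fun z' _ => by
    rw [map_smul, coef_TSum (finite_dcoset l m _), smul_eq_mul]
    by_cases h : z' = z
    · subst h; simp [hw]
    · rw [if_neg h, if_neg, mul_zero]
      intro hw'
      refine h (Subtype.ext (minReps_eq_of_mem z.2 z'.2 ?_))
      rw [← dcoset_eq_of_mem hw, dcoset_eq_of_mem hw']
      exact self_mem_dcoset l m z'.1
  rw [Finset.sum_congr rfl this, Finset.sum_ite_eq']
  split_ifs with h
  · rfl
  · exact (Finsupp.notMem_support_iff.1 h).symm

lemma dcosetSum_injective (l m : Lam n r) : Function.Injective (dcosetSum l m) := fun a b h => by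
  ext1 z
  rw [← coef_dcosetSum l m a z (self_mem_dcoset l m z.1), h,
    coef_dcosetSum l m b z (self_mem_dcoset l m z.1)]

lemma exists_dcosetSum {l m : Lam n r} {h : Hecke r} (H : h ∈ biInvariant l m) :
    ∃ a, h = dcosetSum l m a := by
  let a : minReps l m →₀ 𝓐 :=
    ((TBasis r).repr h).comapDomain Subtype.val Subtype.val_injective.injOn
  refine ⟨a, hecke_ext fun w => ?_⟩
  obtain ⟨z, hz, hw⟩ := exists_minRep l m w
  rw [coef_dcosetSum l m a ⟨z, hz⟩ hw, coef_eq_of_mem_dcoset H hw]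
  rfl

lemma alpha_spec (l m : Lam n r) (w : W r) :
    C (plus l m w) = dcosetSum l m (alpha l m w) := by
  refine theUnique_spec (P := fun a => C (plus l m w) = dcosetSum l m a) ?_
  obtain ⟨a, ha⟩ := exists_dcosetSum (C_plus_mem_biInvariant l m w)
  exact ⟨a, ha, fun b hb => dcosetSum_injective l m (hb.symm.trans ha)⟩

lemma biInvariant_le_range_mulLeft (l m : Lam n r) :
    biInvariant l m ≤ LinearMap.range (LinearMap.mulLeft 𝓐 (xElt l)) := fun h H => by
  obtain ⟨a, rfl⟩ := exists_dcosetSum H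
  refine Submodule.sum_mem _ fun z _ => Submodule.smul_mem _ _
    (TSum_mem_range_mulLeft l (finite_dcoset l m _) fun u hu x hx => ?_)
  simpa using (mul_mem_dcoset hu (one_mem (young m))).2 hx

lemma biInvariant_le_range_mulRight (l m : Lam n r) :
    biInvariant l m ≤ LinearMap.range (LinearMap.mulRight 𝓐 (xElt m)) := fun h H => by
  obtain ⟨a, rfl⟩ := exists_dcosetSum H
  refine Submodule.sum_mem _ fun z _ => Submodule.smul_mem _ _
    (TSum_mem_range_mulRight m (finite_dcoset l m _) fun v hv x hx => ?_)
  simpa using (mul_mem_dcoset (one_mem (young l)) hv).2 hx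

lemma T_mul_xElt {l : Lam n r} {s : W r} (hs : s ∈ simpleRefl r) (hsl : s ∈ young l) :
    T s * xElt l = q • xElt l :=
  T_mul_TSum hs (finite_young l) fun _ hx => mul_mem hsl hx

lemma xElt_mul_T {l : Lam n r} {s : W r} (hs : s ∈ simpleRefl r) (hsl : s ∈ young l) :
    xElt l * T s = q • xElt l := by
  have := congrArg (antiInv r) (T_mul_xElt hs hsl)
  rwa [antiInv_mul, map_smul, antiInv_xElt, antiInv_T, simple_inv hs] at this

/-- Each simple reflection of `W_μ` is a left descent of `w_{0,μ}`, so the coefficients are constant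
on `W_μ`, with value that at `w_{0,μ}`. Outside `W_μ` they vanish because nothing there is below
`w_{0,μ}`. -/
lemma C_w0 (m : Lam n r) : C (w0 m) = tpow (-len (w0 m)) • xElt m := by
  classical
  obtain ⟨h0, h1⟩ := w0_spec m
  refine hecke_ext fun y => ?_
  rw [map_smul, xElt, coef_TSum (finite_young m), young_eq_parabolic, SetLike.mem_coe, smul_eq_mul]
  by_cases hy : y ∈ parabolic r (cuts m)
  · have hinv : ∀ u ∈ parabolic r (cuts m), ∀ w, coef (u * w) (C (w0 m)) = coef w (C (w0 m)) := by
      refine parabolic_induction_left (isCutSet_cuts m) (by simp) fun s hs hsK u _ _ ih w => ?_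
      rw [mul_assoc, coef_eq_of_T_mul hs (T_mul_C hs ?_), ih]
      obtain ⟨v, _, _, hv⟩ := h1 _ (mul_mem hsK h0)
      rcases len_simple_mul hs (w0 m) with h | h <;> omega
    have := hinv _ (mul_mem hy (inv_mem h0)) (w0 m)
    rw [inv_mul_cancel_right] at this
    rw [if_pos hy, mul_one, this, (klCoeffs_C _).self]
  · rw [if_neg hy, mul_zero, (klCoeffs_C _).coef_eq_zero (fun h => hy ((bruhatLE_w0_iff m).1 h))]

/-- The elements `C_{w⁺}` span the elements that are constant on double cosets. -/
lemma biInvariant_le_span (l m : Lam n r) :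
    biInvariant l m ≤ Submodule.span 𝓐 ((fun z => C (plus l m z)) '' minReps l m) := by
  set N := Submodule.span 𝓐 ((fun z => C (plus l m z)) '' minReps l m)
  have key : ∀ z ∈ minReps l m, TSum (dcoset l m z) ∈ N := by
    intro z hz
    induction hn : len (plus l m z) using Nat.strong_induction_on generalizing z with
    | _ k ih =>
      set p := plus l m z with hp
      have hC : C p ∈ N := Submodule.subset_span ⟨z, hz, rfl⟩
      -- Subtracting `t^{l(p)} C_p` cancels the double coset of `z`. The cosets left over have
      -- longest elements strictly below `p` in the Bruhat order.
      obtain ⟨a, ha⟩ := exists_dcosetSum ((biInvariant l m).sub_mem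
        (TSum_dcoset_mem_biInvariant l m z)
        ((biInvariant l m).smul_mem (tpow (len p)) (C_plus_mem_biInvariant l m z)))
      rw [← hp] at ha
      have hN : dcosetSum l m a ∈ N := by
        refine Submodule.sum_mem _ fun z' hz' => Submodule.smul_mem _ _ (ih _ ?_ _ z'.2 rfl)
        have hc := Finsupp.mem_support_iff.1 hz'
        rw [← coef_dcosetSum l m a z' (plus_spec l m z'.1).1, ← ha, map_sub, map_smul,
          coef_TSum (finite_dcoset l m z), smul_eq_mul] at hc
        by_cases hzz : z'.1 = z
        · rw [hzz, if_pos (plus_spec l m z).1, ← hp, (klCoeffs_C p).self, ← tpow_add,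
            add_neg_cancel, tpow_zero, sub_self] at hc
          exact absurd rfl hc
        · have hnm : plus l m z'.1 ∉ dcoset l m z := fun h => hzz (minReps_eq_of_mem hz z'.2 (by
            rw [← dcoset_eq_of_mem h, dcoset_eq_of_mem (plus_spec l m z'.1).1]
            exact self_mem_dcoset l m z'.1))
          rw [if_neg hnm, zero_sub, neg_ne_zero] at hc
          rw [← hn]
          refine bruhatLE.len_lt (v := p) ?_ fun h => hzz (plus_injOn hz z'.2 h)
          by_contra hle
          exact hc (by rw [(klCoeffs_C p).coef_eq_zero hle, mul_zero])
      have e : TSum (dcoset l m z) = dcosetSum l m a + tpow (len p) • C p := by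
        rw [← ha, sub_add_cancel]
      rw [e]
      exact add_mem hN (N.smul_mem _ hC)
  intro h H
  obtain ⟨a, rfl⟩ := exists_dcosetSum H
  exact Submodule.sum_mem _ fun z _ => Submodule.smul_mem _ _ (key z.1 z.2)

end BiInvariant

/-! ### Homomorphisms between the modules `x_λ H` -/

section Schur

variable {r n : ℕ}

/-- The generator of `x_λ H`. -/
def gen (l : Lam n r) : xIdeal l := ⟨xElt l * 1, 1, rfl⟩

lemma proj_incl_same (l : Lam n r) (x : xIdeal l) : proj l (incl l x) = x := by
  classical
  rw [proj, incl, DirectSum.component.of]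
  simp

lemma proj_incl_of_ne {l k : Lam n r} (h : l ≠ k) (x : xIdeal l) : proj k (incl l x) = 0 := by
  classical
  rw [proj, incl, DirectSum.component.of, dif_neg h]

/-- The component in `x_κ H` of the image of the generator of `x_ν H`. -/
def val (v k : Lam n r) : Schur n r →ₗ[𝓐] Hecke r where
  toFun f := (proj k (f (incl v (gen v))) : Hecke r)
  map_add' _ _ := rfl
  map_smul' _ _ := rfl

lemma val_apply (v k : Lam n r) (f : Schur n r) :
    val v k f = (proj k (f (incl v (gen v))) : Hecke r) := rfl

lemma val_mul (v k : Lam n r) (f : Schur n r) (h : Hecke r) :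
    val v k f * h = (proj k (f (incl v ⟨xElt v * h, h, rfl⟩)) : Hecke r) := by
  have e : (⟨xElt v * h, h, rfl⟩ : xIdeal v) = MulOpposite.op h • gen v :=
    Subtype.ext (show xElt v * h = xElt v * 1 * h by rw [mul_one])
  rw [e, map_smul, map_smul, map_smul]
  rfl

lemma val_ext {f f' : Schur n r} (H : ∀ v k, val v k f = val v k f') : f = f' := by
  classical
  refine DirectSum.linearMap_ext _ fun v => LinearMap.ext fun y => ?_
  obtain ⟨_, h, rfl⟩ := y
  refine DFinsupp.ext fun k => Subtype.ext ?_
  have := (val_mul v k f h).symm.trans ((congrArg (· * h) (H v k)).trans (val_mul v k f' h))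
  simp only [incl, proj] at this
  exact this

/-- Left multiplication by `g` as a map `x_μ H → x_λ H`, if `g x_μ ∈ x_λ H`. -/
def mulMap (l m : Lam n r) (g : Hecke r) (hg : g * xElt m ∈ xIdeal l) :
    xIdeal m →ₗ[(Hecke r)ᵐᵒᵖ] xIdeal l where
  toFun y := ⟨g * y.1, by
    obtain ⟨_, h, rfl⟩ := y
    rw [← mul_assoc]
    exact (xIdeal l).smul_mem (MulOpposite.op h) hg⟩
  map_add' a b := Subtype.ext (mul_add g a.1 b.1)
  map_smul' c a := Subtype.ext (mul_assoc g a.1 c.unop).symm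

open Classical in
lemma val_mulMap (l m : Lam n r) (g : Hecke r) (hg : g * xElt m ∈ xIdeal l) (v k : Lam n r) :
    val v k ((incl l).comp ((mulMap l m g hg).comp (proj m))) =
      if v = m ∧ k = l then g * xElt m else 0 := by
  rw [val_apply, LinearMap.comp_apply, LinearMap.comp_apply]
  by_cases hv : v = m
  · subst hv
    rw [proj_incl_same]
    by_cases hk : k = l
    · subst hk
      rw [proj_incl_same, if_pos ⟨rfl, rfl⟩]
      exact congrArg (g * ·) (mul_one _)
    · rw [proj_incl_of_ne (Ne.symm hk), if_neg (fun h => hk h.2)]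
      rfl
  · rw [proj_incl_of_ne hv, map_zero, map_zero, map_zero, if_neg (fun h => hv h.1)]
    rfl

variable [NeZero r]

lemma mem_xIdeal_iff {l : Lam n r} {h : Hecke r} :
    h ∈ xIdeal l ↔ h ∈ LinearMap.range (LinearMap.mulLeft 𝓐 (xElt l)) :=
  ⟨fun ⟨a, ha⟩ => ⟨a, ha.symm⟩, fun ⟨a, ha⟩ => ⟨a, ha.symm⟩⟩

/-- Realizing a map as left multiplication by `g` makes it well defined and right linear at once;
defining it by `x_m h' ↦ h h'` would require annihilators to be compared. -/
lemma exists_mulMap {l m : Lam n r} {h : Hecke r} (H : h ∈ biInvariant l m) :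
    ∃ g, g * xElt m = h ∧ g * xElt m ∈ xIdeal l := by
  obtain ⟨g, hg⟩ := biInvariant_le_range_mulRight l m H
  refine ⟨g, hg, ?_⟩
  rw [show g * xElt m = h from hg, mem_xIdeal_iff]
  exact biInvariant_le_range_mulLeft l m H

open Classical in
lemma isPhi_iff {l m : Lam n r} {w : W r} {f : Schur n r} : IsPhi l m w f ↔
    ∀ v k, val v k f = if v = m ∧ k = l then TSum (dcoset l m w) else 0 := by
  constructor
  · intro H v k
    refine (H v 1 k).trans ?_
    simp only [mul_one]
  · intro H v h k
    rw [← val_mul, H]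
    split_ifs <;> simp

open Classical in
lemma val_phi (l m : Lam n r) (w : W r) (v k : Lam n r) :
    val v k (phi l m w) = if v = m ∧ k = l then TSum (dcoset l m w) else 0 := by
  refine isPhi_iff.1 (theUnique_spec (P := IsPhi l m w) ?_) v k
  obtain ⟨g, hg, hg'⟩ := exists_mulMap (TSum_dcoset_mem_biInvariant l m w)
  refine ⟨(incl l).comp ((mulMap l m g hg').comp (proj m)),
    isPhi_iff.2 fun v k => by rw [val_mulMap, hg], fun f hf => val_ext fun v k => ?_⟩
  rw [isPhi_iff.1 hf, val_mulMap, hg]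

open Classical in
lemma val_theta (B : Triple n r) (v k : Lam n r) : val v k (theta B) =
    if v = B.mu ∧ k = B.lam then tpow (len (w0 B.mu)) • C (plus B.lam B.mu B.w) else 0 := by
  rw [theta, map_smul, Finsupp.sum, map_sum]
  simp only [map_smul, val_phi]
  by_cases h : v = B.mu ∧ k = B.lam
  · simp only [if_pos h]
    rw [alpha_spec]
    rfl
  · simp [if_neg h]

lemma val_mem_biInvariant (v k : Lam n r) (f : Schur n r) : val v k f ∈ biInvariant k v := by
  refine mem_biInvariant_of_eigen (fun s hs hsk => ?_) (fun s hs hsv => ?_)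
  · obtain ⟨h, hh⟩ := (proj k (f (incl v (gen v)))).2
    rw [val_apply, hh, ← mul_assoc, T_mul_xElt hs hsk, smul_mul_assoc]
  -- By right linearity both sides are components of images of elements `x_v h'`, and these elements
  -- agree since `x_v T_s = q x_v`.
  · rw [← mul_one (q • val v k f), smul_mul_assoc, ← mul_smul_comm, val_mul, val_mul]
    congr 5
    rw [xElt_mul_T hs hsv, mul_smul_comm, mul_one]

/-- In a vanishing combination, take among the terms with given `λ, μ` one with longest `w⁺`. Its
coefficient at `w⁺` is a power of `t`, a unit, and no other term contributes there. -/
lemma theta_linearIndependent : LinearIndependent 𝓐 (theta (n := n) (r := r)) := by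
  classical
  let Φ : Schur n r →ₗ[𝓐] (Lam n r × Lam n r → Hecke r) := LinearMap.pi fun p => val p.2 p.1
  refine LinearIndependent.of_comp Φ (linearIndependent_iff'.2 ?_)
  intro s g hg B hB
  by_contra hgB
  let F := s.filter fun B' => g B' ≠ 0 ∧ B'.lam = B.lam ∧ B'.mu = B.mu
  obtain ⟨B0, hB0, hmax⟩ := F.exists_max_image (fun B' => len (plus B'.lam B'.mu B'.w))
    ⟨B, Finset.mem_filter.2 ⟨hB, hgB, rfl, rfl⟩⟩
  obtain ⟨hB0s, hgB0, hlam, hmu⟩ := Finset.mem_filter.1 hB0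
  have h1 := congrArg (coef (plus B0.lam B0.mu B0.w)) (congrFun hg (B0.lam, B0.mu))
  simp only [Finset.sum_apply, Pi.smul_apply, Function.comp_apply, Φ, LinearMap.pi_apply, map_sum,
    map_smul, Pi.zero_apply, map_zero] at h1
  rw [Finset.sum_eq_single_of_mem B0 hB0s] at h1
  · rw [val_theta, if_pos ⟨rfl, rfl⟩, map_smul, (klCoeffs_C _).self, smul_eq_mul, smul_eq_mul,
      ← tpow_add] at h1
    have h2 := congrArg (· * tpow (-(len (w0 B0.mu) + -len (plus B0.lam B0.mu B0.w)))) h1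
    simp only [mul_assoc, ← tpow_add, add_neg_cancel, tpow_zero, mul_one, zero_mul] at h2
    exact hgB0 h2
  · intro B' hB' hne
    rw [val_theta]
    by_cases hg' : g B' = 0
    · rw [hg', zero_smul]
    by_cases hc : B0.mu = B'.mu ∧ B0.lam = B'.lam
    · rw [if_pos hc, map_smul, (klCoeffs_C _).coef_eq_zero, smul_zero, smul_zero]
      intro hle
      have h2 := hmax B' (Finset.mem_filter.2
        ⟨hB', hg', hc.2.symm.trans hlam, hc.1.symm.trans hmu⟩)
      have h3 := hle.eq_of_len_le h2
      obtain ⟨l, m, w, hw⟩ := B'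
      obtain ⟨l0, m0, w0, hw0⟩ := B0
      obtain ⟨rfl, rfl⟩ := hc
      obtain rfl := plus_injOn hw hw0 h3
      exact hne rfl
    · rw [if_neg hc, map_zero, smul_zero]

lemma finite_Lam (hn : 0 < n) : Finite (Lam n r) := by
  have hn' : (0 : ℤ) < n := by exact_mod_cast hn
  have hle : ∀ (l : Lam n r) (i : Fin n), l.1 (i + 1) < r + 1 := fun l i => by
    have := Finset.single_le_sum (f := l.1) (fun _ _ => Nat.zero_le _)
      (Finset.mem_Icc.2 (⟨by omega, by have := i.2; omega⟩ : (1 : ℤ) ≤ i + 1 ∧ (i : ℤ) + 1 ≤ n))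
    rw [l.2.2] at this
    omega
  refine Finite.of_injective (β := Fin n → Fin (r + 1)) (fun l i => ⟨l.1 (i + 1), hle l i⟩)
    fun l l' h => Subtype.ext (funext fun j => ?_)
  have per : ∀ (l : Lam n r) (j k : ℤ), l.1 (j + n * k) = l.1 j := fun l j k => by
    induction k with
    | zero => simp
    | succ k ih => rw [l.2.1, ← ih]; exact congrArg l.1 (by ring)
    | pred k ih => rw [← ih, l.2.1 (j + n * -(k : ℤ))]; exact congrArg l.1 (by ring)
  have h1 := Int.emod_nonneg (j - 1) hn'.ne'
  have h2 := Int.emod_lt_of_pos (j - 1) hn'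
  have h3 := Int.mul_ediv_add_emod (j - 1) n
  have h4 := congrArg Fin.val (congrFun h ⟨((j - 1) % n).toNat, by omega⟩)
  simp only [Int.toNat_of_nonneg h1] at h4
  rw [show j = (j - 1) % n + 1 + n * ((j - 1) / n) by omega, per, per, h4]

/-- Finiteness of `Λ(n,r)` makes `f` a finite sum of its components, and each component is a
combination of elements `C_{w⁺}` by `biInvariant_le_span`. -/
lemma span_theta (hn : 0 < n) : ⊤ ≤ Submodule.span 𝓐 (Set.range (theta (n := n) (r := r))) := by
  classical
  have := finite_Lam (r := r) hn
  have := Fintype.ofFinite (Lam n r)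
  set N := Submodule.span 𝓐 (Set.range (theta (n := n) (r := r)))
  have key : ∀ (l m : Lam n r) (h : Hecke r), h ∈ biInvariant l m →
      ∃ F ∈ N, ∀ v k, val v k F = if v = m ∧ k = l then h else 0 := by
    intro l m h H
    refine Submodule.span_induction (p := fun h _ => ∃ F ∈ N, ∀ v k,
      val v k F = if v = m ∧ k = l then h else 0) ?_ ?_ ?_ ?_ (biInvariant_le_span l m H)
    · rintro _ ⟨z, hz, rfl⟩
      refine ⟨tpow (-len (w0 m)) • theta ⟨l, m, z, hz⟩,
        N.smul_mem _ (Submodule.subset_span ⟨_, rfl⟩), fun v k => ?_⟩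
      rw [map_smul, val_theta, smul_ite, smul_zero, smul_smul, ← tpow_add, neg_add_cancel,
        tpow_zero, one_smul]
    · exact ⟨0, N.zero_mem, fun v k => by simp⟩
    · rintro a b _ _ ⟨F, hF, hF'⟩ ⟨G, hG, hG'⟩
      refine ⟨F + G, N.add_mem hF hG, fun v k => ?_⟩
      rw [map_add, hF', hG']
      split_ifs <;> simp
    · rintro c a _ ⟨F, hF, hF'⟩
      refine ⟨c • F, N.smul_mem c hF, fun v k => ?_⟩
      rw [map_smul, hF', smul_ite, smul_zero]
  rintro f -
  choose F hF hF' using fun p : Lam n r × Lam n r =>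
    key p.1 p.2 (val p.2 p.1 f) (val_mem_biInvariant p.2 p.1 f)
  have e : f = ∑ p, F p := val_ext fun v k => by
    rw [map_sum, Finset.sum_eq_single_of_mem (k, v) (Finset.mem_univ _)]
    · rw [hF', if_pos ⟨rfl, rfl⟩]
    · intro p _ hp
      rw [hF', if_neg]
      rintro ⟨rfl, rfl⟩
      exact hp rfl
  rw [e]
  exact N.sum_mem fun p _ => hF p

lemma C_w0_mem (m : Lam n r) : C (w0 m) ∈ xIdeal m := by
  rw [mem_xIdeal_iff, C_w0]
  exact Submodule.smul_mem _ _ ⟨1, mul_one _⟩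

/-- The map is left multiplication by `g` with `g x_μ = t^{l(w_{0,μ})} C_{w_B⁺}`; the normalization
of `C_{w_{0,μ}}` removes the power of `t`. -/
lemma theta_eq_comp (B : Triple n r) : ∃ f : xIdeal B.mu →ₗ[(Hecke r)ᵐᵒᵖ] xIdeal B.lam,
    theta B = (incl B.lam).comp (f.comp (proj B.mu)) ∧
      ∃ hC : C (w0 B.mu) ∈ xIdeal B.mu,
        (f ⟨C (w0 B.mu), hC⟩ : Hecke r) = C (plus B.lam B.mu B.w) := by
  classical
  obtain ⟨g, hg, hg'⟩ := exists_mulMap ((biInvariant B.lam B.mu).smul_mem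
    (tpow (len (w0 B.mu))) (C_plus_mem_biInvariant B.lam B.mu B.w))
  refine ⟨mulMap B.lam B.mu g hg', val_ext fun v k => by rw [val_theta, val_mulMap, hg],
    C_w0_mem B.mu, ?_⟩
  show g * C (w0 B.mu) = _
  rw [C_w0, mul_smul_comm, hg, smul_smul, ← tpow_add, neg_add_cancel, tpow_zero, one_smul]

end Schur

end AffineSchur

end

theorem theorem3p1 (n r : ℕ) (hn : 0 < n) (hr : 0 < r) :
    (∃ b : Module.Basis (AffineSchur.Triple n r) AffineSchur.𝓐 (AffineSchur.Schur n r),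
      ∀ B : AffineSchur.Triple n r, b B = AffineSchur.theta B) ∧
    (∀ B : AffineSchur.Triple n r,
      ∃ f : AffineSchur.xIdeal B.mu →ₗ[(AffineSchur.Hecke r)ᵐᵒᵖ] AffineSchur.xIdeal B.lam,
        AffineSchur.theta B =
          (AffineSchur.incl B.lam).comp (f.comp (AffineSchur.proj B.mu)) ∧
        ∃ hC : AffineSchur.C (AffineSchur.w0 B.mu) ∈ AffineSchur.xIdeal B.mu,
          (f ⟨AffineSchur.C (AffineSchur.w0 B.mu), hC⟩ : AffineSchur.Hecke r) =
            AffineSchur.C (AffineSchur.plus B.lam B.mu B.w)) := by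
  have : NeZero r := ⟨hr.ne'⟩
  exact ⟨⟨Module.Basis.mk AffineSchur.theta_linearIndependent (AffineSchur.span_theta hn),
    fun B => Module.Basis.mk_apply _ _ B⟩, AffineSchur.theta_eq_comp⟩
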